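/- **Setting.** There are $n$ candidates, split into an advantaged group $G_1$ and a disadvantaged group $G_2$ of sizes $n_1,n_2$, and $p\ge 1$ institutions with capacities $k_1,\dots,k_p\ge 1$; put $K=\sum_\ell k_\ell$. The latent utilities $u_i$ of the candidates are i.i.d. uniform on $[0,1]$; their preference lists $\sigma_i$ (strict rankings of all $p$ institutions) are i.i.d. from an arbitrary distribution $\mathcal L$, independently of the utilities. For a bias parameter $0<\beta\le 1$ the estimated utilities are $\widehat u_i=u_i$ for $i\in G_1$ and $\widehat u_i=\beta u_i$ for $i\in G_2$. The stable assignment $\mathcal A_{\rm st}$ considers the candidates in decreasing order of estimated utility and assigns each one to its most preferred institution that still has an available slot (candidates considered after all slots are filled stay unassigned). Let $\rho_j$ be the fraction of candidates of $G_j$ that are assigned to some institution, $\pi_j$ the fraction of candidates of $G_j$ that are assigned to their first preference, and define $$\mathscr R(\mathcal A_{\rm st})=\mathbb E\Big[\frac{\min(\rho_1,\rho_2)}{\max(\rho_1,\rho_2)}\Big],\qquad \mathscr P(\mathcal A_{\rm st})=\mathbb E\Big[\frac{\min(\pi_1,\pi_2)}{\max(\pi_1,\pi_2)}\Big],\qquad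 \mathscr U(\mathcal A_{\rm st})=\mathbb E\Big[\frac{\sum_{i\ \text{assigned}}u_i}{\text{sum of the } K \text{ largest } u_i}\Big].$$ **Theorem.** There is an absolute constant $C>0$ such that for all such instances with $n_1=n_2=K$ (so $n=2K$), $$\mathscr P(\mathcal A_{\rm st})\le \beta+C\,\frac{p\sqrt{\log n}}{\sqrt n},\qquad \big|\mathscr R(\mathcal A_{\rm st})-\beta\big|\le C\,\frac{\sqrt{\log n}}{\sqrt n},\qquad \Big|\mathscr U(\mathcal A_{\rm st})-\Big(\frac23+\frac{4\beta}{3(\beta+1)^2}\Big)\Big|\le C\,\frac{\sqrt{\log n}}{\sqrt n}.$$ Consequently, up to vanishing error terms, both fairness metrics tend to $0$ and the utility ratio tends to $2/3$ as $\beta\to0$: for every $\varepsilon>0$ there is $\delta>0$ such that for all such instances with $n_1=n_2=K$, $\beta\le\delta$ and $\sqrt{\log n}/\sqrt n\le\delta$, one has $\mathscr R(\mathcal A_{\rm st})\le\varepsilon$ and $|\mathscr U(\mathcal A_{\rm st})-2/3|\le\varepsilon$, and, if moreover $p\sqrt{\log n}/\sqrt n\le\delta$, also $\mathscr P(\mathcal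 A_{\rm st})\le\varepsilon$. -/

import Mathlib

open MeasureTheory

noncomputable section

/-- A strict preference list over the institutions `Fin p`: `σ ℓ` is the position of institution
`ℓ` in the list (position `0` is the top choice). -/
abbrev Pref (p : ℕ) : Type := Equiv.Perm (Fin p)

/-- Every event about a preference list is measurable (there are finitely many lists). -/
instance Pref.instMeasurableSpace (p : ℕ) : MeasurableSpace (Equiv.Perm (Fin p)) := ⊤

/-- A selection: a partial function from candidates to institutions (`none` = not selected). -/
abbrev Selection (n p : ℕ) : Type := Fin n → Option (Fin p)

/-- A selection algorithm: given estimated utilities and preference lists, it outputs a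
selection. -/
abbrev SelectionAlgorithm (n p : ℕ) : Type := (Fin n → ℝ) → (Fin n → Pref p) → Selection n p

/-! ### The stable assignment algorithm -/

/-- The candidates in decreasing order of the values `v` : `decreasingOrder v r` is the candidate
at rank `r` (rank `0` is the best candidate, ties are broken by index). -/
def decreasingOrder {n : ℕ} (v : Fin n → ℝ) : Equiv.Perm (Fin n) :=
  Tuple.sort (fun i => -v i)

/-- The institutions that still have an available slot under `M`. -/
def vacant {n p : ℕ} (k : Fin p → ℕ) (M : Selection n p) : Finset (Fin p) :=
  {ℓ | (Finset.univ.filter (fun i => M i = some ℓ)).card < k ℓ}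

/-- The institution of `S` that is ranked highest by `τ`, if `S` is not empty. -/
def bestIn {p : ℕ} (τ : Pref p) (S : Finset (Fin p)) : Option (Fin p) :=
  if h : (S.image τ).Nonempty then some (τ.symm ((S.image τ).min' h)) else none

/-- Candidate `i` is assigned its most preferred institution with an available slot (and stays
unassigned if there is none). -/
def serveCandidate {n p : ℕ} (k : Fin p → ℕ) (σ : Fin n → Pref p) (M : Selection n p)
    (i : Fin n) : Selection n p :=
  Function.update M i (bestIn (σ i) (vacant k M))

/-- The stable assignment algorithm with capacities `k`: starting from the empty assignment, serve
the candidates one after the other, in decreasing order of estimated utility. -/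
def stableAlg {n p : ℕ} (k : Fin p → ℕ) : SelectionAlgorithm n p := fun v σ =>
  (List.ofFn (decreasingOrder v)).foldl (serveCandidate k σ) (fun _ => none)

/-! ### Bias -/

/-- The estimated utilities: those of the disadvantaged group (`group i = 1`) are multiplied by
`β`, those of the advantaged group (`group i = 0`) are the true ones. -/
def estimated {n : ℕ} (group : Fin n → Fin 2) (β : ℝ) (u : Fin n → ℝ) : Fin n → ℝ :=
  fun i => if group i = 1 then β * u i else u i

/-- The members of group `j`. -/
def groupMembers {n : ℕ} (group : Fin n → Fin 2) (j : Fin 2) : Finset (Fin n) :=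
  {i | group i = j}

/-! ### Quantities attached to one realization -/

/-- The total utility of the selected candidates. -/
def utility {n p : ℕ} (u : Fin n → ℝ) (M : Selection n p) : ℝ :=
  ∑ i with (M i).isSome, u i

/-- The sum of the top `K` entries of `u`. -/
def topUtility {n : ℕ} (K : ℕ) (u : Fin n → ℝ) : ℝ :=
  ∑ r ∈ Finset.univ.filter (fun r : Fin n => r.val < K), u (decreasingOrder u r)

/-- The fraction of the candidates of group `j` that are selected. -/
def selectedFraction {n p : ℕ} (group : Fin n → Fin 2) (M : Selection n p) (j : Fin 2) : ℝ :=
  (((groupMembers group j).filter (fun i => (M i).isSome)).card : ℝ) / (groupMembers group j).card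

/-- The fraction of the candidates of group `j` that get their first preference. -/
def topChoiceFraction {n p : ℕ} (group : Fin n → Fin 2) (σ : Fin n → Pref p) (M : Selection n p)
    (j : Fin 2) : ℝ :=
  (((groupMembers group j).filter (fun i => ∃ ℓ, M i = some ℓ ∧ (σ i ℓ : ℕ) = 0)).card : ℝ) /
    (groupMembers group j).card

/-- The smaller of the values of the two groups divided by the larger one. -/
def minMaxRatio (ρ : Fin 2 → ℝ) : ℝ := min (ρ 0) (ρ 1) / max (ρ 0) (ρ 1)

/-! ### The metrics -/

/-- The law of the latent utilities and the preference lists of `n` candidates: all utilities have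
law `D`, all preference lists have law `L`, and everything is independent. -/
def populationLaw (n : ℕ) {p : ℕ} (D : Measure ℝ) (L : Measure (Pref p)) :
    Measure ((Fin n → ℝ) × (Fin n → Pref p)) :=
  (Measure.pi fun _ => D).prod (Measure.pi fun _ => L)

/-- The utility ratio of `A` (`K` is the total capacity). -/
def utilityRatio {n p : ℕ} (D : Measure ℝ) (L : Measure (Pref p)) (group : Fin n → Fin 2) (β : ℝ)
    (K : ℕ) (A : SelectionAlgorithm n p) : ℝ :=
  ∫ x, utility x.1 (A (estimated group β x.1) x.2) / topUtility K x.1 ∂(populationLaw n D L)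

/-- The representational fairness of `A`. -/
def reprFairness {n p : ℕ} (D : Measure ℝ) (L : Measure (Pref p)) (group : Fin n → Fin 2) (β : ℝ)
    (A : SelectionAlgorithm n p) : ℝ :=
  ∫ x, minMaxRatio (selectedFraction group (A (estimated group β x.1) x.2)) ∂(populationLaw n D L)

/-- The preference-based fairness of `A`. -/
def prefFairness {n p : ℕ} (D : Measure ℝ) (L : Measure (Pref p)) (group : Fin n → Fin 2) (β : ℝ)
    (A : SelectionAlgorithm n p) : ℝ :=
  ∫ x, minMaxRatio (topChoiceFraction group x.2 (A (estimated group β x.1) x.2))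
    ∂(populationLaw n D L)

/-- The uniform distribution on `[0,1]`. -/
def uniform01 : Measure ℝ := volume.restrict (Set.Icc 0 1)

/-! ### Well-definedness of the expectations -/

theorem measurable_decreasingOrder {n : ℕ} :
    Measurable (decreasingOrder : (Fin n → ℝ) → Equiv.Perm (Fin n)) := by
  refine measurable_to_countable' fun e => ?_
  have : (decreasingOrder : (Fin n → ℝ) → Equiv.Perm (Fin n)) ⁻¹' {e} =
      {v | (∀ i j, i ≤ j → v (e j) ≤ v (e i)) ∧ ∀ i j, i < j → v (e i) = v (e j) → e i < e j} := by
    ext v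
    simp only [Set.mem_preimage, Set.mem_singleton_iff, decreasingOrder, eq_comm (b := e),
      Tuple.eq_sort_iff, Monotone, Set.mem_ofPred_eq, Function.comp, neg_le_neg_iff, neg_inj]
  rw [this]
  simp only [Set.ofPred_and, Set.ofPred_forall]
  refine MeasurableSet.inter ?_ ?_
  · exact MeasurableSet.iInter fun i => MeasurableSet.iInter fun j => MeasurableSet.iInter fun _ =>
      measurableSet_le (by fun_prop) (by fun_prop)
  · refine MeasurableSet.iInter fun i => MeasurableSet.iInter fun j => MeasurableSet.iInter fun _ => ?_
    by_cases h : e i < e j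
    · simp [h]
    · simp only [h, imp_false]
      exact (measurableSet_eq_fun (by fun_prop) (by fun_prop)).compl

theorem measurable_estimated {n : ℕ} (group : Fin n → Fin 2) (β : ℝ) :
    Measurable (estimated group β) := by
  refine measurable_pi_lambda _ fun i => ?_
  unfold estimated
  split <;> fun_prop

/-- Every real function of the preference lists and of the selection made by the stable assignment
algorithm is integrable, so that the expectations that define the two fairness metrics exist. -/
theorem integrable_stableAlg {n p : ℕ} (k : Fin p → ℕ) (group : Fin n → Fin 2) (β : ℝ)
    (D : Measure ℝ) [IsProbabilityMeasure D] (L : Measure (Pref p)) [IsProbabilityMeasure L]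
    (F : (Fin n → Pref p) → Selection n p → ℝ) :
    Integrable (fun x : (Fin n → ℝ) × (Fin n → Pref p) =>
      F x.2 (stableAlg k (estimated group β x.1) x.2)) (populationLaw n D L) := by
  let H : Equiv.Perm (Fin n) × (Fin n → Pref p) → ℝ := fun y =>
    F y.2 ((List.ofFn y.1).foldl (serveCandidate k y.2) (fun _ => none))
  have hH : Measurable H := measurable_of_finite H
  have hm : Measurable (fun x : (Fin n → ℝ) × (Fin n → Pref p) =>
      F x.2 (stableAlg k (estimated group β x.1) x.2)) :=
    hH.comp (((measurable_decreasingOrder.comp (measurable_estimated group β)).comp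
      measurable_fst).prodMk measurable_snd)
  obtain ⟨B, hB⟩ := (Set.finite_range H).bddAbove
  obtain ⟨B', hB'⟩ := (Set.finite_range H).bddBelow
  have : IsProbabilityMeasure (populationLaw n D L) := by unfold populationLaw; infer_instance
  refine Integrable.of_mem_Icc B' B hm.aemeasurable (Filter.Eventually.of_forall fun x => ?_)
  exact ⟨hB' ⟨(decreasingOrder (estimated group β x.1), x.2), rfl⟩,
    hB ⟨(decreasingOrder (estimated group β x.1), x.2), rfl⟩⟩

end

/-! Selection ignores preferences: the stable assignment fills all `K` slots with the `K` candidates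
of largest estimated utility. At the threshold `β * s` with `s = 1 / (1 + β)`, the expected number
of candidates above is `K * (1 - β * s) + K * (1 - s) = K`. The selected set and the set above the
threshold are nested, so any `[0,1]`-weighted sums over them differ by at most the error in the head
count (`abs_sum_selected_sub_le`). A variance bound makes the relevant errors `O(√n)` in mean, which
after division by `K` gives `O(1 / √n)` for representational fairness and for utility. The
denominator of the utility ratio is the case `β = 1` of the same estimate.

Preference fairness needs another argument, since nothing is known about which slots are contested.
The ratio is at most the sum, over disadvantaged `i` getting their top choice, of the reciprocal of
the number of advantaged candidates getting theirs; this reciprocal is the share of `i`. Two facts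
control it. If a candidate gets its top choice, raising its estimated utility changes nothing in the
assignment (`stableAlg_update_of_getsTop`), so with everything else fixed the share is a monotone
function of the candidate's own estimated utility. A monotone function has a smaller mean on `[β *
s, β]` than on `[β * s, m]` when `β ≤ m`, so the expected share can be compared with that of the
same candidate moved to the advantaged group (`integral_highShare_le`).

In the modified instance the candidate is one of `K + 1` exchangeable advantaged candidates whose
shares sum to at most one (`sum_lowShare_le_one`), so its expected share is at most `1 / (K + 1)`.
Summing over `K` candidates leaves the factor `(1 - s) / (m - β * s)`. With `m = 1 - w` and `s = (1
- w) / (1 + β)` this is `(β + w) / (1 - w)`, close to `β`, and Hoeffding's bound covers the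
exceptional events. No factor `p` appears; the stated bound is a weakening. -/

noncomputable section

/-! ### The stable assignment as a greedy fixed point -/

/-- Candidate `j` is served before candidate `i`. -/
def Before {n : ℕ} (v : Fin n → ℝ) (j i : Fin n) : Prop := v i < v j ∨ (v j = v i ∧ j < i)

/-- The rank of a candidate in the decreasing order of `v`. -/
def rank {n : ℕ} (v : Fin n → ℝ) (i : Fin n) : Fin n := (decreasingOrder v).symm i

theorem rank_lt_iff {n : ℕ} (v : Fin n → ℝ) (j i : Fin n) :
    rank v j < rank v i ↔ Before v j i := by
  have key : ∀ a b : Fin n, rank v a < rank v b → Before v a b := by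
    intro a b hab
    obtain ⟨h1, h2⟩ := (Tuple.eq_sort_iff (f := fun i => -v i) (σ := decreasingOrder v)).1 rfl
    have h3 := h1 hab.le
    have h4 := h2 _ _ hab
    simp only [rank, Function.comp, Equiv.apply_symm_apply, neg_le_neg_iff, neg_inj] at h3 h4
    rcases h3.lt_or_eq with h | h
    · exact Or.inl h
    · exact Or.inr ⟨h.symm, h4 h.symm⟩
  refine ⟨key j i, fun h => ?_⟩
  by_contra hn
  rcases (not_lt.1 hn).lt_or_eq with h' | h'
  · rcases key i j h' with h1 | ⟨h1, h2⟩ <;> rcases h with h3 | ⟨h3, h4⟩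
    · linarith
    · linarith
    · linarith
    · exact lt_asymm h2 h4
  · have : i = j := (decreasingOrder v).symm.injective h'
    subst this
    rcases h with h3 | ⟨h3, h4⟩
    · exact lt_irrefl _ h3
    · exact lt_irrefl _ h4

theorem bestIn_eq_some {p : ℕ} (τ : Pref p) (S : Finset (Fin p)) (ℓ : Fin p) :
    bestIn τ S = some ℓ ↔ ℓ ∈ S ∧ ∀ m ∈ S, τ ℓ ≤ τ m := by
  unfold bestIn
  split_ifs with h
  · have hm := (S.image τ).min'_mem h
    have hle := fun m (hm : m ∈ S) => (S.image τ).min'_le _ (Finset.mem_image_of_mem τ hm)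
    obtain ⟨a, ha, hae⟩ := Finset.mem_image.1 hm
    constructor
    · intro he
      have : a = ℓ := by simpa [← hae] using he
      subst this
      exact ⟨ha, fun m hm' => hae ▸ hle m hm'⟩
    · rintro ⟨h1, h2⟩
      have : τ ℓ = (S.image τ).min' h := le_antisymm (hae ▸ h2 a ha) (hle ℓ h1)
      simp [← this]
  · simp only [Finset.image_nonempty, Finset.not_nonempty_iff_eq_empty] at h
    simp [h]

theorem bestIn_eq_none {p : ℕ} (τ : Pref p) (S : Finset (Fin p)) :
    bestIn τ S = none ↔ S = ∅ := by
  unfold bestIn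
  split_ifs with h
  · simpa using (Finset.image_nonempty.1 h).ne_empty
  · simpa [Finset.not_nonempty_iff_eq_empty] using h

open Classical in
/-- The institutions that still have an available slot, under `M`, when `i` is served. -/
def openAt {n p : ℕ} (k : Fin p → ℕ) (v : Fin n → ℝ) (M : Selection n p) (i : Fin n) :
    Finset (Fin p) :=
  {ℓ | (Finset.univ.filter (fun j => Before v j i ∧ M j = some ℓ)).card < k ℓ}

/-- Every candidate gets the best institution that the earlier candidates leave open. -/
def IsServed {n p : ℕ} (k : Fin p → ℕ) (σ : Fin n → Pref p) (v : Fin n → ℝ)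
    (M : Selection n p) : Prop :=
  ∀ i, M i = bestIn (σ i) (openAt k v M i)

theorem foldl_serveCandidate_of_notMem {n p : ℕ} (k : Fin p → ℕ) (σ : Fin n → Pref p)
    (l : List (Fin n)) (M : Selection n p) (i : Fin n) (hi : i ∉ l) :
    l.foldl (serveCandidate k σ) M i = M i := by
  induction l generalizing M with
  | nil => rfl
  | cons a l ih =>
    simp only [List.mem_cons, not_or] at hi
    rw [List.foldl_cons, ih _ hi.2, serveCandidate, Function.update_of_ne hi.1]

/-- Cut the serving list at `i`. The fold over the part before `i` already has the final values of
exactly the candidates `Before` `i`, and the part after `i` never touches `i`. -/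
theorem isServed_stableAlg {n p : ℕ} (k : Fin p → ℕ) (σ : Fin n → Pref p) (v : Fin n → ℝ) :
    IsServed k σ v (stableAlg k v σ) := by
  classical
  intro i
  set e := decreasingOrder v with he
  set r := rank v i with hr
  have hei : e r = i := by simp [hr, rank, he]
  set l₁ := (List.ofFn e).take r
  set l₂ := (List.ofFn e).drop (r + 1)
  have hsplit : List.ofFn e = l₁ ++ i :: l₂ := by
    have h1 : (r : ℕ) < (List.ofFn e).length := by simp
    have h2 : (List.ofFn e)[(r : ℕ)] = i := by simp [hei]
    rw [← h2, ← List.drop_eq_getElem_cons h1, List.take_append_drop]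
  have hnd : (l₁ ++ i :: l₂).Nodup := hsplit ▸ List.nodup_ofFn.2 e.injective
  have hmem : ∀ j, j ∈ l₁ ↔ Before v j i := by
    intro j
    rw [← rank_lt_iff, ← hr]
    simp only [l₁, List.mem_take_iff_getElem, List.getElem_ofFn, List.length_ofFn]
    constructor
    · rintro ⟨m, hm, rfl⟩
      simp only [rank, ← he, Equiv.symm_apply_apply]
      exact Fin.lt_def.2 (lt_of_lt_of_le hm (min_le_left _ _))
    · intro h
      refine ⟨rank v j, lt_min h (rank v j).2, ?_⟩
      simp [rank, he]
  have hall : ∀ j, j ∈ l₁ ++ i :: l₂ := fun j => by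
    rw [← hsplit, List.mem_ofFn]; exact e.surjective j
  have hst : stableAlg k v σ = (l₁ ++ i :: l₂).foldl (serveCandidate k σ) (fun _ => none) := by
    rw [← hsplit]; rfl
  rw [List.nodup_append] at hnd
  obtain ⟨hn1, hn2, hdis⟩ := hnd
  have hi2 : i ∉ l₂ := (List.nodup_cons.1 hn2).1
  set M₁ := l₁.foldl (serveCandidate k σ) (fun _ => none) with hM1
  have hfinal : stableAlg k v σ = l₂.foldl (serveCandidate k σ) (serveCandidate k σ M₁ i) := by
    rw [hst, List.foldl_append, List.foldl_cons]
  have hM : ∀ j ℓ, M₁ j = some ℓ ↔ Before v j i ∧ stableAlg k v σ j = some ℓ := by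
    intro j ℓ
    rw [← hmem]
    by_cases hj : j ∈ l₁
    · have hj2 : j ∉ i :: l₂ := fun h => hdis j hj j h rfl
      simp only [List.mem_cons, not_or] at hj2
      rw [hfinal, foldl_serveCandidate_of_notMem _ _ _ _ _ hj2.2, serveCandidate,
        Function.update_of_ne hj2.1]
      simp [hj]
    · rw [hM1, foldl_serveCandidate_of_notMem _ _ _ _ _ hj]
      simp [hj]
  have hv : vacant k M₁ = openAt k v (stableAlg k v σ) i := by
    ext ℓ
    simp only [vacant, openAt, Finset.mem_filter, Finset.mem_univ, true_and, hM]
  rw [← hv]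
  conv_lhs => rw [hfinal, foldl_serveCandidate_of_notMem _ _ _ _ _ hi2, serveCandidate,
    Function.update_self]

/-- What a candidate sees depends only on those served earlier, so induction on the rank determines
everything. Later proofs identify a stable assignment by checking this local condition, without
running the fold. -/
theorem IsServed.unique {n p : ℕ} {k : Fin p → ℕ} {σ : Fin n → Pref p} {v : Fin n → ℝ}
    {M M' : Selection n p} (h : IsServed k σ v M) (h' : IsServed k σ v M') : M = M' := by
  classical
  suffices H : ∀ (r : ℕ) (i : Fin n), (rank v i : ℕ) = r → M i = M' i from
    funext fun i => H _ i rfl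
  intro r
  induction r using Nat.strong_induction_on with
  | _ r ih =>
    intro i hi
    rw [h i, h' i]
    congr 1
    ext ℓ
    simp only [openAt, Finset.mem_filter, Finset.mem_univ, true_and]
    have : ∀ j, (Before v j i ∧ M j = some ℓ) ↔ (Before v j i ∧ M' j = some ℓ) := by
      intro j
      refine and_congr_right fun hj => ?_
      rw [ih (rank v j) (hi ▸ (rank_lt_iff v j i).2 hj) j rfl]
    simp only [this]

theorem IsServed.eq_stableAlg {n p : ℕ} {k : Fin p → ℕ} {σ : Fin n → Pref p} {v : Fin n → ℝ}
    {M : Selection n p} (h : IsServed k σ v M) : M = stableAlg k v σ :=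
  h.unique (isServed_stableAlg k σ v)

/-- The last candidate to enter `ℓ` still found a free slot there. -/
theorem card_assigned_le {n p : ℕ} (k : Fin p → ℕ) (σ : Fin n → Pref p) (v : Fin n → ℝ)
    (ℓ : Fin p) :
    (Finset.univ.filter (fun i => stableAlg k v σ i = some ℓ)).card ≤ k ℓ := by
  classical
  set A := Finset.univ.filter (fun i => stableAlg k v σ i = some ℓ) with hA
  rcases A.eq_empty_or_nonempty with h | h
  · simp [h]
  obtain ⟨i, hi, hmax⟩ := A.exists_max_image (rank v) h
  have h1 := isServed_stableAlg k σ v i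
  have hi' : stableAlg k v σ i = some ℓ := by simpa [hA] using hi
  rw [hi'] at h1
  have h2 := ((bestIn_eq_some _ _ _).1 h1.symm).1
  simp only [openAt, Finset.mem_filter, Finset.mem_univ, true_and] at h2
  have h3 : A.erase i ⊆ Finset.univ.filter
      (fun j => Before v j i ∧ stableAlg k v σ j = some ℓ) := by
    intro j hj
    rw [Finset.mem_erase] at hj
    have hj' : stableAlg k v σ j = some ℓ := by simpa [hA] using hj.2
    simp only [Finset.mem_filter, Finset.mem_univ, true_and]
    refine ⟨(rank_lt_iff v j i).1 (lt_of_le_of_ne (hmax j hj.2) fun h => hj.1 ?_), hj'⟩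
    exact (decreasingOrder v).symm.injective h
  have h4 := Finset.card_le_card h3
  have h5 := Finset.card_erase_add_one hi
  omega

theorem card_rank_lt {n : ℕ} (v : Fin n → ℝ) (m : ℕ) (hm : m ≤ n) :
    (Finset.univ.filter (fun i => (rank v i : ℕ) < m)).card = m := by
  have h : (Finset.univ.filter (fun i => (rank v i : ℕ) < m)).card
      = (Finset.univ.filter (fun r : Fin n => (r : ℕ) < m)).card := by
    refine Finset.card_bij (fun i _ => rank v i) (by simp)
      (fun a _ b _ h => (decreasingOrder v).symm.injective h) ?_
    intro r hr
    refine ⟨decreasingOrder v r, Finset.mem_filter.2 ⟨Finset.mem_univ _, ?_⟩, by simp [rank]⟩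
    simpa [rank] using (Finset.mem_filter.1 hr).2
  rw [h, Fin.card_filter_val_lt, min_eq_right hm]

/-- An unassigned candidate finds every institution full, so at least `K` candidates precede it.
Hence the first `K` are all assigned, and the capacities leave no room for more. -/
theorem filter_isSome_stableAlg {n p : ℕ} (k : Fin p → ℕ) (σ : Fin n → Pref p)
    (v : Fin n → ℝ) (hK : ∑ ℓ, k ℓ ≤ n) :
    Finset.univ.filter (fun i => (stableAlg k v σ i).isSome)
      = Finset.univ.filter (fun i => (rank v i : ℕ) < ∑ ℓ, k ℓ) := by
  classical
  have hsum : ∀ A : Finset (Fin n), ∑ ℓ, (A.filter (fun j => stableAlg k v σ j = some ℓ)).card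
      = (A.filter (fun j => (stableAlg k v σ j).isSome)).card := by
    intro A
    rw [← Finset.card_biUnion]
    · congr 1
      ext j
      simp [Option.isSome_iff_exists]
    · intro a _ b _ hab
      refine Finset.disjoint_left.2 fun j h1 h2 => hab ?_
      simp only [Finset.mem_filter] at h1 h2
      simpa [h1.2] using h2.2
  symm
  refine Finset.eq_of_subset_of_card_le ?_ ?_
  · intro i hi
    simp only [Finset.mem_filter, Finset.mem_univ, true_and] at hi ⊢
    by_contra hn
    have hn' : stableAlg k v σ i = none := by simpa using hn
    have h1 := isServed_stableAlg k σ v i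
    rw [hn', eq_comm, bestIn_eq_none] at h1
    have h2 : ∀ ℓ, k ℓ ≤ ((Finset.univ.filter (fun j => Before v j i)).filter
        (fun j => stableAlg k v σ j = some ℓ)).card := by
      intro ℓ
      have : ℓ ∉ openAt k v (stableAlg k v σ) i := by simp [h1]
      simpa [openAt, Finset.filter_filter] using this
    have h3 := Finset.sum_le_sum fun ℓ (_ : ℓ ∈ Finset.univ) => h2 ℓ
    rw [hsum] at h3
    have h4 : (Finset.univ.filter (fun j => Before v j i)).card = rank v i := by
      rw [← card_rank_lt v (rank v i) (rank v i).2.le]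
      simp only [← rank_lt_iff, Fin.lt_def]
    have h5 := Finset.card_filter_le (Finset.univ.filter (fun j => Before v j i))
      (fun j => (stableAlg k v σ j).isSome)
    omega
  · rw [card_rank_lt _ _ hK, ← hsum]
    exact Finset.sum_le_sum fun ℓ _ => card_assigned_le k σ v ℓ

/-! ### First preferences and the effect of a candidate's own utility -/

/-- Candidate `i` is assigned to its first preference. -/
def GetsTop {n p : ℕ} (σ : Fin n → Pref p) (M : Selection n p) (i : Fin n) : Prop :=
  ∃ ℓ, M i = some ℓ ∧ (σ i ℓ : ℕ) = 0

theorem GetsTop.isSome {n p : ℕ} {σ : Fin n → Pref p} {M : Selection n p} {i : Fin n}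
    (h : GetsTop σ M i) : (M i).isSome := by
  obtain ⟨ℓ, h, -⟩ := h
  simp [h]

theorem getsTop_of_forall_not_before {n p : ℕ} (hp : 0 < p) {k : Fin p → ℕ} (hk : ∀ ℓ, 1 ≤ k ℓ)
    (σ : Fin n → Pref p) (v : Fin n → ℝ) (i : Fin n) (hi : ∀ j, ¬ Before v j i) :
    GetsTop σ (stableAlg k v σ) i := by
  have : NeZero p := ⟨hp.ne'⟩
  refine ⟨(σ i).symm 0, ?_, by simp⟩
  rw [isServed_stableAlg k σ v i, bestIn_eq_some]
  refine ⟨?_, fun m _ => by simp⟩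
  have := hk ((σ i).symm 0)
  simp only [openAt, hi, false_and, Finset.filter_false, Finset.card_empty, Finset.mem_filter,
    Finset.mem_univ, true_and]
  omega

/-- Taking the top choice earlier uses up a slot that `i` would get anyway. Overtaken candidates see
one more occupied slot at that institution `ℓ` only, and those who hold a slot of `ℓ` keep it:
together with `i` they still fit into the capacity. The old assignment therefore still satisfies the
greedy condition. -/
theorem stableAlg_update_of_getsTop {n p : ℕ} (k : Fin p → ℕ) (σ : Fin n → Pref p)
    (v : Fin n → ℝ) (i : Fin n) {x y : ℝ} (hxy : x ≤ y)
    (h : GetsTop σ (stableAlg k (Function.update v i x) σ) i) :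
    stableAlg k (Function.update v i y) σ = stableAlg k (Function.update v i x) σ := by
  classical
  symm
  apply IsServed.eq_stableAlg
  obtain ⟨ℓ, hℓ, htop⟩ := h
  set vx := Function.update v i x with hvx
  set vy := Function.update v i y with hvy
  set M := stableAlg k vx σ with hM
  have hserve : IsServed k σ vx M := isServed_stableAlg k σ vx
  have hne : ∀ a b, a ≠ i → b ≠ i → (Before vy a b ↔ Before vx a b) := by
    intro a b ha hb
    simp [Before, hvx, hvy, ha, hb]
  have hup : ∀ a, Before vy a i → Before vx a i := by
    intro a ha
    by_cases hai : a = i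
    · subst hai; simp [Before] at ha
    · simp only [Before, hvx, hvy, Function.update_self, Function.update_of_ne hai] at ha ⊢
      rcases ha with ha | ha
      · exact Or.inl (lt_of_le_of_lt hxy ha)
      · rcases hxy.lt_or_eq with h | h
        · exact Or.inl (by linarith [ha.1])
        · exact Or.inr ⟨by linarith [ha.1], ha.2⟩
  have hdown : ∀ b, Before vx i b → Before vy i b := by
    intro b hb
    by_cases hbi : b = i
    · subst hbi; simp [Before] at hb
    · simp only [Before, hvx, hvy, Function.update_self, Function.update_of_ne hbi] at hb ⊢
      rcases hb with hb | hb
      · exact Or.inl (by linarith)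
      · rcases hxy.lt_or_eq with h | h
        · exact Or.inl (by linarith [hb.1])
        · exact Or.inr ⟨by linarith [hb.1], hb.2⟩
  have htot : ∀ a, a ≠ i → ¬ Before vx i a → Before vx a i := by
    intro a ha h
    rw [← rank_lt_iff] at h ⊢
    exact lt_of_le_of_ne (not_lt.1 h) fun h => ha ((decreasingOrder vx).symm.injective h)
  have htrans : ∀ a b c, Before vx a b → Before vx b c → Before vx a c := by
    intro a b c; simp only [← rank_lt_iff]; exact lt_trans
  have hirr : ∀ a, ¬ Before vx a a := by intro a; simp [← rank_lt_iff]
  have hopen := ((bestIn_eq_some _ _ _).1 ((hserve i).symm.trans hℓ)).1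
  simp only [openAt, Finset.mem_filter, Finset.mem_univ, true_and] at hopen
  intro a
  by_cases hai : a = i
  · subst hai
    rw [hℓ, eq_comm, bestIn_eq_some]
    constructor
    · simp only [openAt, Finset.mem_filter, Finset.mem_univ, true_and]
      refine lt_of_le_of_lt (Finset.card_le_card ?_) hopen
      intro j hj
      simp only [Finset.mem_filter, Finset.mem_univ, true_and] at hj ⊢
      exact ⟨hup j hj.1, hj.2⟩
    · intro m _
      rw [Fin.le_def, htop]; exact Nat.zero_le _
  -- If `i` does not overtake `a`, the same candidates precede `a` in both orders.
  · by_cases hxa : Before vx i a ∨ ¬ Before vy i a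
    · have hiff : ∀ j, Before vy j a ↔ Before vx j a := by
        intro j
        by_cases hj : j = i
        · subst hj
          rcases hxa with h | h
          · exact ⟨fun _ => h, fun _ => hdown a h⟩
          · exact ⟨fun h' => absurd h' h, fun h' => absurd (hdown a h') h⟩
        · exact hne j a hj hai
      rw [hserve a]
      simp only [openAt, hiff]
    · push Not at hxa
      have hax : Before vx a i := htot a hai hxa.1
      have hcount : ∀ m, m ≠ ℓ → (Finset.univ.filter (fun j => Before vy j a ∧ M j = some m))
          = Finset.univ.filter (fun j => Before vx j a ∧ M j = some m) := by
        intro m hm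
        ext j
        simp only [Finset.mem_filter, Finset.mem_univ, true_and]
        refine and_congr_left fun hj => hne j a (fun hji => hm ?_) hai
        subst hji
        simpa [hℓ] using hj.symm
      have hsub : openAt k vy M a ⊆ openAt k vx M a := by
        intro m
        simp only [openAt, Finset.mem_filter, Finset.mem_univ, true_and]
        refine lt_of_le_of_lt (Finset.card_le_card fun j hj => ?_)
        simp only [Finset.mem_filter, Finset.mem_univ, true_and] at hj ⊢
        exact ⟨(hne j a (fun hji => hxa.1 (hji ▸ hj.1)) hai).2 hj.1, hj.2⟩
      have hMa := hserve a
      cases hm : M a with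
      | none =>
        rw [hm, eq_comm, bestIn_eq_none] at hMa
        rw [eq_comm, bestIn_eq_none, ← Finset.subset_empty, ← hMa]
        exact hsub
      | some m =>
        rw [hm, eq_comm, bestIn_eq_some] at hMa
        rw [eq_comm, bestIn_eq_some]
        refine ⟨?_, fun m' hm' => hMa.2 m' (hsub hm')⟩
        by_cases hmℓ : m = ℓ
        · subst hmℓ
          simp only [openAt, Finset.mem_filter, Finset.mem_univ, true_and]
          refine lt_of_le_of_lt ?_ hopen
          -- The holders of a slot of `ℓ` now preceding `a` are `i` or candidates who preceded `i`
          -- before. Among the latter `a` itself is not counted, which compensates for `i`.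
          have h1 : (Finset.univ.filter (fun j => Before vy j a ∧ M j = some m)) ⊆
              insert i ((Finset.univ.filter (fun j => Before vx j i ∧ M j = some m)).erase a) := by
            intro j hj
            simp only [Finset.mem_filter, Finset.mem_univ, true_and, Finset.mem_insert,
              Finset.mem_erase] at hj ⊢
            by_cases hji : j = i
            · exact Or.inl hji
            · have h2 := (hne j a hji hai).1 hj.1
              exact Or.inr ⟨fun h => hirr a (h ▸ h2), htrans _ _ _ h2 hax, hj.2⟩
          have h3 := Finset.card_erase_add_one
            (s := Finset.univ.filter (fun j => Before vx j i ∧ M j = some m)) (a := a)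
            (by simp [hax, hm])
          have h4 := (Finset.card_le_card h1).trans (Finset.card_insert_le _ _)
          omega
        · have := hMa.1
          simp only [openAt, Finset.mem_filter, Finset.mem_univ, true_and] at this ⊢
          rwa [hcount m hmℓ]

/-! ### Sums over independent uniform utilities -/

instance isProbabilityMeasure_uniform01 : IsProbabilityMeasure uniform01 :=
  ⟨by simp [uniform01]⟩

theorem ae_mem_uniform01 : ∀ᵐ x ∂uniform01, x ∈ Set.Icc (0 : ℝ) 1 :=
  ae_restrict_mem measurableSet_Icc

theorem ae_mem_pi_uniform01 (n : ℕ) :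
    ∀ᵐ u ∂(Measure.pi fun _ : Fin n => uniform01), ∀ i, u i ∈ Set.Icc (0 : ℝ) 1 :=
  ae_all_iff.2 fun i => (measurePreserving_eval (fun _ : Fin n => uniform01) i).quasiMeasurePreserving.ae
    ae_mem_uniform01

/-- Permuting the coordinates preserves the law of an i.i.d. family. -/
theorem measurePreserving_comp_perm {n : ℕ} {α : Type*} [MeasurableSpace α] (μ : Measure α)
    [SigmaFinite μ] (e : Equiv.Perm (Fin n)) :
    MeasurePreserving (fun (x : Fin n → α) i => x (e i)) (Measure.pi fun _ => μ)
      (Measure.pi fun _ => μ) := by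
  exact measurePreserving_arrowCongr' (α₁ := Fin n) (α₂ := Fin n) (β₁ := α) (β₂ := α)
    (fun _ => μ) (fun _ => μ) e.symm (MeasurableEquiv.refl α) (fun _ => MeasurePreserving.id μ)

/-- Resampling one coordinate preserves the law of an independent family. -/
theorem measurePreserving_update {n : ℕ} {α : Type*} [MeasurableSpace α] (μ : Measure α)
    [IsProbabilityMeasure μ] (i : Fin n) :
    MeasurePreserving (fun y : (Fin n → α) × α => Function.update y.1 i y.2)
      ((Measure.pi fun _ => μ).prod μ) (Measure.pi fun _ => μ) := by
  have hm : Measurable (fun y : (Fin n → α) × α => Function.update y.1 i y.2) :=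
    measurable_pi_lambda _ fun j => by
      by_cases h : j = i
      · subst h; simpa using measurable_snd
      · simp only [Function.update_of_ne h]; fun_prop
  refine ⟨hm, (Measure.pi_eq fun s hs => ?_).symm⟩
  rw [Measure.map_apply hm (MeasurableSet.univ_pi hs)]
  have : (fun y : (Fin n → α) × α => Function.update y.1 i y.2) ⁻¹' (Set.univ.pi s)
      = (Set.univ.pi (Function.update s i Set.univ)) ×ˢ s i := by
    ext y
    simp only [Set.mem_preimage, Set.mem_pi, Set.mem_univ, true_imp_iff, Set.mem_prod]
    constructor
    · intro h
      refine ⟨fun j => ?_, by simpa using h i⟩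
      by_cases hj : j = i
      · subst hj; simp
      · simpa [hj] using h j
    · rintro ⟨h1, h2⟩ j
      by_cases hj : j = i
      · subst hj; simpa using h2
      · simpa [hj] using h1 j
  rw [this, Measure.prod_prod, Measure.pi_pi, ← Finset.mul_prod_erase Finset.univ
    (fun j => μ (s j)) (Finset.mem_univ i), ← Finset.mul_prod_erase Finset.univ
    (fun j => μ (Function.update s i Set.univ j)) (Finset.mem_univ i), mul_comm (μ (s i))]
  simp only [Function.update_self, measure_univ, one_mul]
  congr 1
  exact Finset.prod_congr rfl fun j hj => by rw [Function.update_of_ne (Finset.ne_of_mem_erase hj)]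

theorem ae_sum_mem_Icc {n : ℕ} {f : Fin n → ℝ → ℝ}
    (h01 : ∀ i, ∀ x ∈ Set.Icc (0 : ℝ) 1, f i x ∈ Set.Icc (0 : ℝ) 1) :
    ∀ᵐ u ∂(Measure.pi fun _ : Fin n => uniform01), ∑ i, f i (u i) ∈ Set.Icc (0 : ℝ) n := by
  filter_upwards [ae_mem_pi_uniform01 n] with u hu
  refine ⟨Finset.sum_nonneg fun i _ => (h01 i _ (hu i)).1, ?_⟩
  calc ∑ i, f i (u i) ≤ ∑ _i : Fin n, (1 : ℝ) := Finset.sum_le_sum fun i _ => (h01 i _ (hu i)).2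
    _ = n := by simp

theorem memLp_uniform01 {f : ℝ → ℝ} (hf : Measurable f)
    (h01 : ∀ x ∈ Set.Icc (0 : ℝ) 1, f x ∈ Set.Icc (0 : ℝ) 1) (q : ENNReal) :
    MemLp f q uniform01 :=
  memLp_of_bounded (a := 0) (b := 1) (ae_mem_uniform01.mono fun x hx => h01 x hx)
    hf.aestronglyMeasurable q

theorem memLp_sum_pi_uniform01 {n : ℕ} {f : Fin n → ℝ → ℝ} (hf : ∀ i, Measurable (f i))
    (h01 : ∀ i, ∀ x ∈ Set.Icc (0 : ℝ) 1, f i x ∈ Set.Icc (0 : ℝ) 1) (q : ENNReal) :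
    MemLp (fun u : Fin n → ℝ => ∑ i, f i (u i)) q (Measure.pi fun _ => uniform01) :=
  memLp_of_bounded (a := 0) (b := n) (ae_sum_mem_Icc h01)
    (Finset.measurable_sum _ fun i _ =>
      (hf i).comp (measurable_pi_apply i)).aestronglyMeasurable q

theorem integral_eval_pi_uniform01 {n : ℕ} {g : ℝ → ℝ} (hg : Measurable g) (i : Fin n) :
    ∫ u, g (u i) ∂(Measure.pi fun _ : Fin n => uniform01) = ∫ x, g x ∂uniform01 := by
  have hmp := measurePreserving_eval (fun _ : Fin n => uniform01) i
  have := integral_map (μ := Measure.pi fun _ : Fin n => uniform01) hmp.measurable.aemeasurable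
    (f := g) hg.aestronglyMeasurable
  rw [hmp.map_eq] at this
  exact this.symm

theorem integral_sum_pi_uniform01 {n : ℕ} {f : Fin n → ℝ → ℝ} (hf : ∀ i, Measurable (f i))
    (h01 : ∀ i, ∀ x ∈ Set.Icc (0 : ℝ) 1, f i x ∈ Set.Icc (0 : ℝ) 1) :
    ∫ u, ∑ i, f i (u i) ∂(Measure.pi fun _ : Fin n => uniform01)
      = ∑ i, ∫ x, f i x ∂uniform01 := by
  have hmp := fun i => measurePreserving_eval (fun _ : Fin n => uniform01) i
  rw [integral_finsetSum]
  · exact Finset.sum_congr rfl fun i _ => integral_eval_pi_uniform01 (hf i) i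
  · exact fun i _ => (hmp i).integrable_comp_of_integrable
      ((memLp_uniform01 (hf i) (h01 i) 1).integrable le_rfl)

/-- The mean absolute deviation of a sum of independent `[0,1]`-valued random variables. -/
theorem integral_abs_sum_sub_le {n : ℕ} {f : Fin n → ℝ → ℝ} (hf : ∀ i, Measurable (f i))
    (h01 : ∀ i, ∀ x ∈ Set.Icc (0 : ℝ) 1, f i x ∈ Set.Icc (0 : ℝ) 1) :
    ∫ u, |∑ i, f i (u i) - ∑ i, ∫ x, f i x ∂uniform01| ∂(Measure.pi fun _ : Fin n => uniform01)
      ≤ √n := by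
  set μ := Measure.pi fun _ : Fin n => uniform01
  set m := ∑ i, ∫ x, f i x ∂uniform01
  set X : (Fin n → ℝ) → ℝ := fun u => ∑ i, f i (u i) with hX
  have hL : MemLp X 2 μ := memLp_sum_pi_uniform01 hf h01 2
  have hmean : ∫ u, X u ∂μ = m := integral_sum_pi_uniform01 hf h01
  have hvar : ProbabilityTheory.variance X μ ≤ n := by
    have h1 := ProbabilityTheory.variance_sum_pi (μ := fun _ : Fin n => uniform01)
      (X := f) (fun i => memLp_uniform01 (hf i) (h01 i) 2)
    have h2 : (∑ i, fun ω : Fin n → ℝ => f i (ω i)) = X := by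
      ext u; simp [hX]
    rw [h2] at h1
    rw [h1]
    calc _ ≤ ∑ _i : Fin n, (1 : ℝ) := Finset.sum_le_sum fun i _ => ?_
      _ = n := by simp
    refine (ProbabilityTheory.variance_le_sq_of_bounded (a := 0) (b := 1)
      (ae_mem_uniform01.mono fun x hx => h01 i x hx) (hf i).aemeasurable).trans (by norm_num)
  have hL1 : MemLp (fun u => X u - m) 2 μ := hL.sub (memLp_const m)
  have hsq : ∫ u, |X u - m| ^ 2 ∂μ ≤ n := by
    rw [ProbabilityTheory.variance_eq_integral hL.aestronglyMeasurable.aemeasurable, hmean] at hvar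
    simpa [sq_abs] using hvar
  refine Real.le_sqrt_of_sq_le ?_
  -- Nonnegativity of this variance bounds the squared mean of `|X u - m|` by its second moment.
  have hv := ProbabilityTheory.variance_nonneg (fun u => |X u - m|) μ
  rw [ProbabilityTheory.variance_eq_sub (X := fun u => |X u - m|) hL1.abs] at hv
  have : ∫ u, ((fun u => |X u - m|) ^ 2) u ∂μ ≤ n := hsq
  linarith

/-- Hoeffding's bound for the lower tail of a sum of independent `[0,1]`-valued random
variables. -/
theorem measureReal_sum_le_le_exp {n : ℕ} {f : Fin n → ℝ → ℝ} (hf : ∀ i, Measurable (f i))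
    (h01 : ∀ i, ∀ x ∈ Set.Icc (0 : ℝ) 1, f i x ∈ Set.Icc (0 : ℝ) 1) {s : ℝ} (hs : 0 ≤ s) :
    (Measure.pi fun _ : Fin n => uniform01).real
      {u | ∑ i, f i (u i) ≤ ∑ i, ∫ x, f i x ∂uniform01 - s} ≤ Real.exp (-(2 * s ^ 2 / n)) := by
  set μ := Measure.pi fun _ : Fin n => uniform01
  set g : Fin n → ℝ → ℝ := fun i x => (∫ y, f i y ∂uniform01) - f i x with hg
  have hgm : ∀ i, Measurable (g i) := fun i => by have := hf i; fun_prop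
  have hind : ProbabilityTheory.iIndepFun (fun i (u : Fin n → ℝ) => g i (u i)) μ :=
    ProbabilityTheory.iIndepFun_pi fun i => (hgm i).aemeasurable
  -- Each centred term is sub-Gaussian with parameter `1 / 4`; the sum has parameter `n / 4`, whence
  -- the exponent `2 * s ^ 2 / n`. The sign in `g` turns the lower tail into an upper one.
  have hsub : ∀ i ∈ Finset.univ, ProbabilityTheory.HasSubgaussianMGF
      (fun u : Fin n → ℝ => g i (u i)) ((1 / 2) ^ 2) μ := by
    intro i _
    have h1 := ProbabilityTheory.hasSubgaussianMGF_of_mem_Icc (μ := μ) (a := 0) (b := 1)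
      (X := fun u => f i (u i)) ((hf i).comp (measurable_pi_apply i)).aemeasurable
      ((ae_mem_pi_uniform01 n).mono fun u hu => h01 i _ (hu i))
    have h2 : ∫ u, f i (u i) ∂μ = ∫ y, f i y ∂uniform01 :=
      integral_eval_pi_uniform01 (hf i) i
    have h3 := h1.neg
    convert! h3 using 1
    · ext u; simp [hg, h2]
    · congr 1
      rw [← NNReal.coe_inj]
      simp
  have := ProbabilityTheory.HasSubgaussianMGF.measure_sum_ge_le_of_iIndepFun hind hsub hs
  convert! this using 2
  · ext u
    simp only [Set.mem_ofPred_eq, hg, Finset.sum_sub_distrib]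
    constructor <;> intro h <;> linarith
  · simp
    ring

theorem integral_indicator_Ici_uniform01 {θ : ℝ} (h0 : 0 ≤ θ) (h1 : θ ≤ 1) :
    ∫ x, (Set.Ici θ).indicator (fun _ => (1 : ℝ)) x ∂uniform01 = 1 - θ := by
  rw [integral_indicator measurableSet_Ici, uniform01, Measure.restrict_restrict measurableSet_Ici]
  have : Set.Ici θ ∩ Set.Icc 0 1 = Set.Icc θ 1 := by
    ext x; simp only [Set.mem_inter_iff, Set.mem_Ici, Set.mem_Icc]; grind
  rw [this]
  simp [h1]

theorem integral_indicator_Ici_mul_uniform01 {θ : ℝ} (h0 : 0 ≤ θ) (h1 : θ ≤ 1) :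
    ∫ x, (Set.Ici θ).indicator (fun x => x) x ∂uniform01 = (1 - θ ^ 2) / 2 := by
  rw [integral_indicator measurableSet_Ici, uniform01, Measure.restrict_restrict measurableSet_Ici]
  have : Set.Ici θ ∩ Set.Icc 0 1 = Set.Icc θ 1 := by
    ext x; simp only [Set.mem_inter_iff, Set.mem_Ici, Set.mem_Icc]; grind
  rw [this, integral_Icc_eq_integral_Ioc, ← intervalIntegral.integral_of_le h1]
  simp

/-! ### Truncated means of monotone functions -/

/-- A monotone function has a smaller average over an initial segment of an interval. -/
theorem Monotone.integral_initial_le {φ : ℝ → ℝ} (hφ : Monotone φ) {a b c : ℝ} (hab : a ≤ b)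
    (hbc : b ≤ c) :
    (c - a) * ∫ x in a..b, φ x ≤ (b - a) * ∫ x in a..c, φ x := by
  have hi := fun x y => hφ.intervalIntegrable (μ := volume) (a := x) (b := y)
  have h1 : ∫ x in a..b, φ x ≤ (b - a) * φ b := by
    have := intervalIntegral.integral_mono_on hab (hi a b)
      (intervalIntegrable_const (c := φ b)) (fun x hx => hφ hx.2)
    simpa using this
  have h2 : (c - b) * φ b ≤ ∫ x in b..c, φ x := by
    have := intervalIntegral.integral_mono_on hbc (intervalIntegrable_const (c := φ b)) (hi b c)
      (fun x hx => hφ hx.1)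
    simpa using this
  rw [← intervalIntegral.integral_add_adjacent_intervals (hi a b) (hi b c)]
  have h3 := mul_le_mul_of_nonneg_left h1 (sub_nonneg.2 hbc)
  have h4 := mul_le_mul_of_nonneg_left h2 (sub_nonneg.2 hab)
  nlinarith

/-- Rescaling the argument of a monotone function by `β` lowers its truncated mean. -/
theorem Monotone.integral_rescale_le {φ : ℝ → ℝ} (hφ : Monotone φ) {β t m : ℝ} (hβ : 0 < β)
    (h0 : 0 ≤ t) (htβ : t < β) (hβm : β ≤ m) (hm1 : m ≤ 1) :
    ∫ x, {x | t ≤ β * x}.indicator (fun x => φ (β * x)) x ∂uniform01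
      ≤ (β - t) / (β * (m - t)) * ∫ x, (Set.Ico t m).indicator φ x ∂uniform01 := by
  have hms : MeasurableSet {x : ℝ | t ≤ β * x} := measurableSet_le (by fun_prop) (by fun_prop)
  have hL : {x : ℝ | t ≤ β * x} ∩ Set.Icc 0 1 = Set.Icc (t / β) 1 := by
    ext x
    simp only [Set.mem_inter_iff, Set.mem_ofPred_eq, Set.mem_Icc, div_le_iff₀' hβ]
    constructor
    · tauto
    · intro h
      refine ⟨h.1, ?_, h.2⟩
      by_contra hx
      nlinarith [mul_neg_of_pos_of_neg hβ (not_le.1 hx)]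
  have hR : Set.Ico t m ∩ Set.Icc 0 1 = Set.Ico t m := by
    rw [Set.inter_eq_left]; exact Set.Ico_subset_Icc_self.trans (Set.Icc_subset_Icc h0 hm1)
  have ht1 : t / β ≤ 1 := by rw [div_le_one hβ]; exact htβ.le
  rw [integral_indicator hms, integral_indicator measurableSet_Ico, uniform01,
    Measure.restrict_restrict hms, Measure.restrict_restrict measurableSet_Ico, hL, hR,
    integral_Icc_eq_integral_Ioc, integral_Ico_eq_integral_Ioo, ← integral_Ioc_eq_integral_Ioo,
    ← intervalIntegral.integral_of_le ht1, ← intervalIntegral.integral_of_le (by linarith),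
    intervalIntegral.integral_comp_mul_left _ hβ.ne', mul_div_cancel₀ _ hβ.ne', mul_one,
    smul_eq_mul]
  have := hφ.integral_initial_le htβ.le hβm
  have hmt : 0 < m - t := by linarith
  rw [div_mul_eq_mul_div, le_div_iff₀ (by positivity)]
  calc _ = (m - t) * ∫ x in t..β, φ x := by field_simp
    _ ≤ _ := this

/-- Ties are broken by index, which is not invariant under relabelling; exchangeability needs them
to be null. With the other coordinates fixed, a tie excludes a single value of `u i`. -/
theorem ae_injective_estimated {n : ℕ} (group : Fin n → Fin 2) {β : ℝ} (hβ : 0 < β) :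
    ∀ᵐ u ∂(Measure.pi fun _ : Fin n => uniform01), Function.Injective (estimated group β u) := by
  have hne : ∀ i j : Fin n, i ≠ j → ∀ᵐ u ∂(Measure.pi fun _ : Fin n => uniform01),
      estimated group β u i ≠ estimated group β u j := by
    intro i j hij
    set c : Fin n → ℝ := fun a => if group a = 1 then β else 1 with hc
    have hc0 : ∀ a, c a ≠ 0 := fun a => by simp only [hc]; split_ifs <;> positivity
    have hest : ∀ u a, estimated group β u a = c a * u a := fun u a => by
      simp only [estimated, hc]; split_ifs <;> simp
    simp only [hest]
    have hms : MeasurableSet {u : Fin n → ℝ | c i * u i ≠ c j * u j} :=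
      (measurableSet_eq_fun (by fun_prop) (by fun_prop)).compl
    rw [← (measurePreserving_update uniform01 i).map_eq,
      ae_map_iff (measurePreserving_update uniform01 i).measurable.aemeasurable hms]
    refine (Measure.ae_prod_iff_ae_ae (p := fun z : (Fin n → ℝ) × ℝ =>
      c i * Function.update z.1 i z.2 i ≠ c j * Function.update z.1 i z.2 j)
      ((measurePreserving_update uniform01 i).measurable hms)).2 ?_
    refine Filter.Eventually.of_forall fun u => ?_
    have : ∀ᵐ x ∂uniform01, x ≠ c j * u j / c i :=
      ae_restrict_of_ae (Measure.ae_ne volume _)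
    filter_upwards [this] with x hx
    rw [Function.update_self, Function.update_of_ne hij.symm]
    intro h
    exact hx (by rw [← h, mul_div_cancel_left₀ _ (hc0 i)])
  have : ∀ᵐ u ∂(Measure.pi fun _ : Fin n => uniform01), ∀ i j, i ≠ j →
      estimated group β u i ≠ estimated group β u j := by
    simp only [ae_all_iff]
    intro i j hij
    exact hne i j hij
  filter_upwards [this] with u hu i j h
  by_contra hij
  exact hu i j hij h

/-! ### Comparison of the selected candidates with a threshold set -/

theorem abs_sum_sub_sum_le_of_subset {ι : Type*} [DecidableEq ι] {w : ι → ℝ} {A B : Finset ι}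
    (hw : ∀ i ∈ B, w i ∈ Set.Icc (0 : ℝ) 1) (h : A ⊆ B) :
    |∑ i ∈ B, w i - ∑ i ∈ A, w i| ≤ |(B.card : ℝ) - A.card| := by
  have h1 := Finset.sum_sdiff (f := w) h
  have h2 := Finset.card_sdiff_add_card_eq_card h
  have h3 : 0 ≤ ∑ i ∈ B \ A, w i :=
    Finset.sum_nonneg fun i hi => (hw i (Finset.mem_sdiff.1 hi).1).1
  have h4 : ∑ i ∈ B \ A, w i ≤ (B \ A).card := by
    have := Finset.sum_le_sum (s := B \ A) (f := w) (g := fun _ => 1)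
      fun i hi => (hw i (Finset.mem_sdiff.1 hi).1).2
    simpa using this
  have h5 : ((B \ A).card : ℝ) + A.card = B.card := by exact_mod_cast h2
  rw [← h1, ← h5, add_sub_cancel_right, add_sub_cancel_right, abs_of_nonneg h3,
    abs_of_nonneg (Nat.cast_nonneg _)]
  exact h4

/-- Both sets are initial segments of the serving order. -/
theorem selected_subset_or_superset {n p : ℕ} (k : Fin p → ℕ) (σ : Fin n → Pref p)
    (v : Fin n → ℝ) (hK : ∑ ℓ, k ℓ ≤ n) (θ : ℝ) :
    Finset.univ.filter (fun i => (stableAlg k v σ i).isSome) ⊆ Finset.univ.filter (fun i => θ ≤ v i)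
    ∨ Finset.univ.filter (fun i => θ ≤ v i) ⊆
      Finset.univ.filter (fun i => (stableAlg k v σ i).isSome) := by
  rw [filter_isSome_stableAlg k σ v hK]
  by_contra! hcon
  obtain ⟨a, ha, ha'⟩ := Finset.not_subset.1 hcon.1
  obtain ⟨b, hb, hb'⟩ := Finset.not_subset.1 hcon.2
  simp only [Finset.mem_filter, Finset.mem_univ, true_and] at ha ha' hb hb'
  have : rank v b < rank v a := (rank_lt_iff v b a).2 (Or.inl (by linarith))
  rw [Fin.lt_def] at this
  omega

theorem card_selected {n p : ℕ} (k : Fin p → ℕ) (σ : Fin n → Pref p)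
    (v : Fin n → ℝ) (hK : ∑ ℓ, k ℓ ≤ n) :
    (Finset.univ.filter (fun i => (stableAlg k v σ i).isSome)).card = ∑ ℓ, k ℓ := by
  rw [filter_isSome_stableAlg k σ v hK, card_rank_lt _ _ hK]

/-- The selected candidates differ from the candidates above a threshold by a chain. -/
theorem abs_sum_selected_sub_le {n p : ℕ} (k : Fin p → ℕ) (σ : Fin n → Pref p)
    (v : Fin n → ℝ) (hK : ∑ ℓ, k ℓ ≤ n) (θ : ℝ) {w : Fin n → ℝ}
    (hw : ∀ i, w i ∈ Set.Icc (0 : ℝ) 1) :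
    |∑ i with (stableAlg k v σ i).isSome, w i - ∑ i with θ ≤ v i, w i|
      ≤ |((Finset.univ.filter (fun i => θ ≤ v i)).card : ℝ) - ((∑ ℓ, k ℓ : ℕ) : ℝ)| := by
  have hc := card_selected k σ v hK
  rcases selected_subset_or_superset k σ v hK θ with h | h
  · have := abs_sum_sub_sum_le_of_subset (w := w) (fun i _ => hw i) h
    rwa [hc, abs_sub_comm] at this
  · have := abs_sum_sub_sum_le_of_subset (w := w) (fun i _ => hw i) h
    rwa [hc, abs_sub_comm (_ : ℝ) ((∑ ℓ, k ℓ : ℕ) : ℝ)] at *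

/-- This makes the denominator of the utility ratio an instance of the stable assignment without
bias. -/
theorem topUtility_eq_utility {n p : ℕ} (k : Fin p → ℕ) (σ : Fin n → Pref p)
    (u : Fin n → ℝ) (hK : ∑ ℓ, k ℓ ≤ n) :
    topUtility (∑ ℓ, k ℓ) u = utility u (stableAlg k u σ) := by
  rw [utility, filter_isSome_stableAlg k σ u hK, topUtility]
  refine Finset.sum_bij (fun r _ => decreasingOrder u r) ?_
    (fun a _ b _ h => (decreasingOrder u).injective h) ?_ (fun _ _ => rfl)
  · intro r hr
    refine Finset.mem_filter.2 ⟨Finset.mem_univ _, ?_⟩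
    simpa [rank] using (Finset.mem_filter.1 hr).2
  · intro i hi
    refine ⟨rank u i, Finset.mem_filter.2 ⟨Finset.mem_univ _, ?_⟩, by simp [rank]⟩
    simpa using (Finset.mem_filter.1 hi).2

theorem estimated_one {n : ℕ} (group : Fin n → Fin 2) (u : Fin n → ℝ) :
    estimated group 1 u = u := by
  ext i; simp [estimated]

/-- The threshold on the latent utility that corresponds to the threshold `β * s` on the estimated
utility. -/
def cutoff {n : ℕ} (group : Fin n → Fin 2) (β s : ℝ) (i : Fin n) : ℝ :=
  if group i = 1 then s else β * s

theorem cutoff_le_iff {n : ℕ} (group : Fin n → Fin 2) {β : ℝ} (hβ : 0 < β) (s : ℝ)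
    (u : Fin n → ℝ) (i : Fin n) :
    cutoff group β s i ≤ u i ↔ β * s ≤ estimated group β u i := by
  unfold cutoff estimated
  split_ifs
  · exact (mul_le_mul_iff_right₀ hβ).symm
  · rfl

theorem cutoff_mem {n : ℕ} (group : Fin n → Fin 2) {β s : ℝ} (hβ : 0 < β) (hβ1 : β ≤ 1)
    (h0 : 0 ≤ s) (h1 : s ≤ 1) (i : Fin n) : 0 ≤ cutoff group β s i ∧ cutoff group β s i ≤ 1 := by
  unfold cutoff
  split_ifs
  · exact ⟨h0, h1⟩
  · exact ⟨by positivity, by nlinarith⟩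

section groups

variable {n K : ℕ} {group : Fin n → Fin 2}

theorem sum_ite_group (hcard : ∀ j, (groupMembers group j).card = K) (a b : ℝ) :
    ∑ i, (if group i = 1 then a else b) = K * a + K * b := by
  have h0 : (Finset.univ.filter (fun i => ¬ group i = 1)) = groupMembers group 0 := by
    ext i
    simp only [groupMembers, Finset.mem_filter, Finset.mem_univ, true_and]
    omega
  have h1 : (Finset.univ.filter (fun i => group i = 1)) = groupMembers group 1 := rfl
  rw [Finset.sum_ite, h0, h1]
  simp [hcard]

theorem eq_two_mul_of_card (hcard : ∀ j, (groupMembers group j).card = K) : (n : ℝ) = 2 * K := by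
  have := sum_ite_group hcard 1 1
  simp at this
  linarith

end groups

theorem sum_indicator_cutoff {n : ℕ} (group : Fin n → Fin 2) {β : ℝ} (hβ : 0 < β) (s : ℝ)
    (u : Fin n → ℝ) (W : Fin n → ℝ → ℝ) :
    ∑ i, (Set.Ici (cutoff group β s i)).indicator (W i) (u i)
      = ∑ i with β * s ≤ estimated group β u i, W i (u i) := by
  rw [Finset.sum_filter]
  refine Finset.sum_congr rfl fun i _ => ?_
  simp only [Set.indicator_apply, Set.mem_Ici, cutoff_le_iff group hβ]

/-- The weighted number of candidates above a threshold, for weights `W i` of the latent utility,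
has small mean absolute deviation. -/
theorem integral_abs_sum_cutoff_sub_le {n : ℕ} (group : Fin n → Fin 2) {β s : ℝ} (hβ : 0 < β)
    {W : Fin n → ℝ → ℝ} (hW : ∀ i, Measurable (W i))
    (h01 : ∀ i, ∀ x ∈ Set.Icc (0 : ℝ) 1, W i x ∈ Set.Icc (0 : ℝ) 1) {m : ℝ}
    (hm : ∑ i, ∫ x, (Set.Ici (cutoff group β s i)).indicator (W i) x ∂uniform01 = m) :
    Integrable (fun u => |∑ i with β * s ≤ estimated group β u i, W i (u i) - m|)
      (Measure.pi fun _ => uniform01) ∧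
    ∫ u, |∑ i with β * s ≤ estimated group β u i, W i (u i) - m|
      ∂(Measure.pi fun _ => uniform01) ≤ √n := by
  have hf : ∀ i, Measurable ((Set.Ici (cutoff group β s i)).indicator (W i)) :=
    fun i => (hW i).indicator measurableSet_Ici
  have hf01 : ∀ i, ∀ x ∈ Set.Icc (0 : ℝ) 1,
      (Set.Ici (cutoff group β s i)).indicator (W i) x ∈ Set.Icc (0 : ℝ) 1 := by
    intro i x hx
    rw [Set.indicator_apply]
    split_ifs
    · exact h01 i x hx
    · simp
  have h1 := integral_abs_sum_sub_le hf hf01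
  have h2 := (((memLp_sum_pi_uniform01 hf hf01 1).integrable le_rfl).sub (integrable_const m)).abs
  simp only [hm, sum_indicator_cutoff group hβ] at h1 h2
  exact ⟨h2, h1⟩

/-- The bound `Y` depends on the utilities alone, so the law of the preferences disappears from the
estimate. -/
theorem abs_integral_populationLaw_sub_le {n p : ℕ} (L : Measure (Pref p)) [IsProbabilityMeasure L]
    {g : (Fin n → ℝ) × (Fin n → Pref p) → ℝ}
    (hg : AEStronglyMeasurable g (populationLaw n uniform01 L)) {c : ℝ}
    {Y : (Fin n → ℝ) → ℝ} (hY : Integrable Y (Measure.pi fun _ => uniform01))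
    (h : ∀ u, (∀ i, u i ∈ Set.Icc (0 : ℝ) 1) → ∀ σ, |g (u, σ) - c| ≤ Y u) :
    |∫ x, g x ∂(populationLaw n uniform01 L) - c| ≤ ∫ u, Y u ∂(Measure.pi fun _ => uniform01) := by
  have hp : IsProbabilityMeasure (populationLaw n uniform01 L) := by
    unfold populationLaw; infer_instance
  have hmp : MeasurePreserving Prod.fst (populationLaw n uniform01 L)
      (Measure.pi fun _ : Fin n => uniform01) := by
    unfold populationLaw; exact measurePreserving_fst
  have hY' : Integrable (fun x : (Fin n → ℝ) × (Fin n → Pref p) => Y x.1)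
      (populationLaw n uniform01 L) := hmp.integrable_comp_of_integrable hY
  have hae : ∀ᵐ x ∂(populationLaw n uniform01 L), |g x - c| ≤ Y x.1 := by
    filter_upwards [hmp.quasiMeasurePreserving.ae (ae_mem_pi_uniform01 n)] with x hx
    exact h x.1 hx x.2
  have hgc : Integrable (fun x => g x - c) (populationLaw n uniform01 L) :=
    hY'.mono' (hg.sub aestronglyMeasurable_const) hae
  have hgi : Integrable g (populationLaw n uniform01 L) := by
    exact (hgc.add (integrable_const c)).congr (ae_of_all _ fun x => by simp)
  have h1 : ∫ x, g x ∂(populationLaw n uniform01 L) - c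
      = ∫ x, (g x - c) ∂(populationLaw n uniform01 L) := by
    rw [integral_sub hgi (integrable_const c)]; simp
  have h2 : ∫ x, Y x.1 ∂(populationLaw n uniform01 L) = ∫ u, Y u ∂(Measure.pi fun _ => uniform01) := by
    have := integral_map (μ := populationLaw n uniform01 L) (f := Y)
      hmp.measurable.aemeasurable (by rw [hmp.map_eq]; exact hY.aestronglyMeasurable)
    rw [hmp.map_eq] at this
    exact this.symm
  rw [h1, ← h2]
  exact (abs_integral_le_integral_abs).trans (integral_mono_ae hgc.abs hY' hae)

/-- The map `y ↦ (1 - y) / y` takes the value `β` at `1 / (1 + β)`, and on `[1/2, ∞)` the difference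
quotient from that point is at most `(1 + β) / y ≤ 4`. For `x < 1/2`, reflection to `1 - x` only
moves closer to `1 / (1 + β) ≥ 1/2`. -/
theorem abs_min_div_max_sub_le {x β : ℝ} (hβ : 0 < β) (hβ1 : β ≤ 1) :
    |min x (1 - x) / max x (1 - x) - β| ≤ 4 * |x - 1 / (1 + β)| := by
  have key : ∀ y : ℝ, 1 / 2 ≤ y → |(1 - y) / y - β| ≤ 4 * |y - 1 / (1 + β)| := by
    intro y hy
    have hy0 : 0 < y := by linarith
    have : (1 - y) / y - β = -((1 + β) / y) * (y - 1 / (1 + β)) := by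
      field_simp; ring
    rw [this, abs_mul, abs_neg, abs_of_pos (by positivity)]
    refine mul_le_mul_of_nonneg_right ?_ (abs_nonneg _)
    rw [div_le_iff₀ hy0]; linarith
  have hb : 1 / 2 ≤ 1 / (1 + β) := by
    apply one_div_le_one_div_of_le <;> linarith
  rcases le_total (1 / 2) x with h | h
  · rw [min_eq_right (by linarith), max_eq_left (by linarith)]
    exact key x h
  · rw [min_eq_left (by linarith), max_eq_right (by linarith)]
    have := key (1 - x) (by linarith)
    rw [sub_sub_cancel] at this
    refine this.trans ?_
    rw [abs_sub_comm x, abs_of_nonneg (by linarith : 0 ≤ 1 / (1 + β) - x)]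
    refine mul_le_mul_of_nonneg_left (abs_le.2 ⟨by linarith, by linarith⟩) (by norm_num)

section means

variable {n K : ℕ} {group : Fin n → Fin 2} {β s : ℝ}

theorem sum_integral_cutoff_one (hcard : ∀ j, (groupMembers group j).card = K) (hβ : 0 < β)
    (hβ1 : β ≤ 1) (h0 : 0 ≤ s) (h1 : s ≤ 1) :
    ∑ i, ∫ x, (Set.Ici (cutoff group β s i)).indicator (fun _ => (1 : ℝ)) x ∂uniform01
      = K * (2 - (1 + β) * s) := by
  have : ∀ i, ∫ x, (Set.Ici (cutoff group β s i)).indicator (fun _ => (1 : ℝ)) x ∂uniform01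
      = if group i = 1 then 1 - s else 1 - β * s := by
    intro i
    have hc := cutoff_mem group hβ hβ1 h0 h1 i
    rw [integral_indicator_Ici_uniform01 hc.1 hc.2, cutoff]
    split_ifs <;> rfl
  simp only [this, sum_ite_group hcard]
  ring

theorem sum_integral_cutoff_group (hcard : ∀ j, (groupMembers group j).card = K) (hβ : 0 < β)
    (hβ1 : β ≤ 1) (h0 : 0 ≤ s) (h1 : s ≤ 1) :
    ∑ i, ∫ x, (Set.Ici (cutoff group β s i)).indicator
      (fun _ => if group i = 1 then (0 : ℝ) else 1) x ∂uniform01 = K * (1 - β * s) := by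
  have : ∀ i, ∫ x, (Set.Ici (cutoff group β s i)).indicator
      (fun _ => if group i = 1 then (0 : ℝ) else 1) x ∂uniform01
      = if group i = 1 then 0 else 1 - β * s := by
    intro i
    have hc := cutoff_mem group hβ hβ1 h0 h1 i
    by_cases h : group i = 1
    · simp [h]
    · simp only [h, if_false]
      rw [integral_indicator_Ici_uniform01 hc.1 hc.2, cutoff, if_neg h]
  simp only [this, sum_ite_group hcard]
  ring

theorem sum_integral_cutoff_id (hcard : ∀ j, (groupMembers group j).card = K) (hβ : 0 < β)
    (hβ1 : β ≤ 1) (h0 : 0 ≤ s) (h1 : s ≤ 1) :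
    ∑ i, ∫ x, (Set.Ici (cutoff group β s i)).indicator (fun x => x) x ∂uniform01
      = K * ((2 - s ^ 2 - (β * s) ^ 2) / 2) := by
  have : ∀ i, ∫ x, (Set.Ici (cutoff group β s i)).indicator (fun x => x) x ∂uniform01
      = if group i = 1 then (1 - s ^ 2) / 2 else (1 - (β * s) ^ 2) / 2 := by
    intro i
    have hc := cutoff_mem group hβ hβ1 h0 h1 i
    rw [integral_indicator_Ici_mul_uniform01 hc.1 hc.2, cutoff]
    split_ifs <;> rfl
  simp only [this, sum_ite_group hcard]
  ring

end means

/-! ### Representational fairness and the utility ratio -/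

section metrics

variable {n p : ℕ} {k : Fin p → ℕ} {group : Fin n → Fin 2} {β : ℝ}

theorem total_capacity_pos (hp : 0 < p) (hk : ∀ ℓ, 1 ≤ k ℓ) : 0 < ∑ ℓ, k ℓ :=
  lt_of_lt_of_le (hk ⟨0, hp⟩) (Finset.single_le_sum (fun _ _ => Nat.zero_le _) (Finset.mem_univ _))

theorem total_capacity_le (hcard : ∀ j, (groupMembers group j).card = ∑ ℓ, k ℓ) :
    ∑ ℓ, k ℓ ≤ n := by
  rw [← hcard 0]
  simpa using Finset.card_le_univ (groupMembers group 0)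

theorem selectedFraction_one_eq (hp : 0 < p) (hk : ∀ ℓ, 1 ≤ k ℓ)
    (hcard : ∀ j, (groupMembers group j).card = ∑ ℓ, k ℓ) (v : Fin n → ℝ) (σ : Fin n → Pref p) :
    selectedFraction group (stableAlg k v σ) 1 = 1 - selectedFraction group (stableAlg k v σ) 0 := by
  have hK : (0 : ℝ) < (∑ ℓ, k ℓ : ℕ) := by exact_mod_cast total_capacity_pos hp hk
  have hsel := card_selected k σ v (total_capacity_le hcard)
  have hsplit := Finset.card_filter_add_card_filter_not
    (s := Finset.univ.filter (fun i => (stableAlg k v σ i).isSome)) (fun i => group i = 0)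
  rw [hsel] at hsplit
  have h0 : (groupMembers group 0).filter (fun i => (stableAlg k v σ i).isSome)
      = (Finset.univ.filter (fun i => (stableAlg k v σ i).isSome)).filter (fun i => group i = 0) := by
    ext i; simp [groupMembers, and_comm]
  have h1 : (groupMembers group 1).filter (fun i => (stableAlg k v σ i).isSome)
      = (Finset.univ.filter (fun i => (stableAlg k v σ i).isSome)).filter
        (fun i => ¬ group i = 0) := by
    ext i
    simp only [groupMembers, Finset.mem_filter, Finset.mem_univ, true_and]
    have : group i = 1 ↔ ¬ group i = 0 := by omega
    rw [this, and_comm]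
  simp only [selectedFraction, h0, h1, hcard]
  rw [eq_sub_iff_add_eq, ← add_div, div_eq_one_iff_eq hK.ne', ← hsplit]
  push_cast
  ring

theorem card_selected_group_zero (v : Fin n → ℝ) (σ : Fin n → Pref p) :
    (((groupMembers group 0).filter (fun i => (stableAlg k v σ i).isSome)).card : ℝ)
      = ∑ i with (stableAlg k v σ i).isSome, if group i = 1 then (0 : ℝ) else 1 := by
  rw [Finset.sum_ite, Finset.sum_const_zero, zero_add, Finset.sum_const, nsmul_eq_mul, mul_one]
  congr 2
  ext i
  simp only [groupMembers, Finset.mem_filter, Finset.mem_univ, true_and]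
  have : group i = 0 ↔ ¬ group i = 1 := by omega
  rw [this, and_comm]

theorem abs_reprFairness_sub_le (hp : 0 < p) (hk : ∀ ℓ, 1 ≤ k ℓ)
    (hcard : ∀ j, (groupMembers group j).card = ∑ ℓ, k ℓ) (hβ : 0 < β) (hβ1 : β ≤ 1)
    (L : Measure (Pref p)) [IsProbabilityMeasure L] :
    |reprFairness uniform01 L group β (stableAlg k) - β| ≤ 16 / √n := by
  set K := ∑ ℓ, k ℓ with hKdef
  have hK : (0 : ℝ) < K := by exact_mod_cast total_capacity_pos hp hk
  have hn : (n : ℝ) = 2 * K := eq_two_mul_of_card hcard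
  have hKn : K ≤ n := total_capacity_le hcard
  -- This `s` makes the expected head count `K * (2 - (1 + β) * s)` equal to `K`.
  set s := 1 / (1 + β) with hs
  have hs0 : 0 ≤ s := by positivity
  have hs1 : s ≤ 1 := by rw [hs, div_le_one (by positivity)]; linarith
  have hβs : (1 + β) * s = 1 := by rw [hs]; field_simp
  have hA := integral_abs_sum_cutoff_sub_le group hβ (W := fun _ _ => (1 : ℝ)) (s := s)
    (fun i => measurable_const) (fun i x _ => by simp)
    (sum_integral_cutoff_one hcard hβ hβ1 hs0 hs1)
  have hB := integral_abs_sum_cutoff_sub_le group hβ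
    (W := fun i _ => if group i = 1 then (0 : ℝ) else 1) (s := s)
    (fun i => measurable_const) (fun i x _ => by split_ifs <;> simp)
    (sum_integral_cutoff_group hcard hβ hβ1 hs0 hs1)
  have hY := (hA.1.add hB.1).const_mul (4 / (K : ℝ))
  refine (abs_integral_populationLaw_sub_le L
    (integrable_stableAlg k group β uniform01 L
      (fun _ M => minMaxRatio (selectedFraction group M))).aestronglyMeasurable hY ?_).trans ?_
  · intro u hu σ
    simp only [minMaxRatio, selectedFraction_one_eq hp hk hcard]
    refine (abs_min_div_max_sub_le hβ hβ1).trans ?_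
    have h1 := abs_sum_selected_sub_le k σ (estimated group β u) hKn (β * s)
      (w := fun i => if group i = 1 then (0 : ℝ) else 1) (fun i => by split_ifs <;> simp)
    rw [← card_selected_group_zero, ← hKdef] at h1
    have h2 : selectedFraction group (stableAlg k (estimated group β u) σ) 0 - 1 / (1 + β)
        = (((groupMembers group 0).filter
          (fun i => (stableAlg k (estimated group β u) σ i).isSome)).card - K * (1 - β * s)) / K := by
      rw [selectedFraction, hcard, ← hs, show 1 - β * s = s by linarith]
      field_simp
    rw [h2, abs_div, abs_of_pos hK, div_mul_eq_mul_div, mul_div_assoc]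
    refine mul_le_mul_of_nonneg_left ((div_le_div_iff_of_pos_right hK).2 ?_) (by norm_num)
    have h3 : (K : ℝ) * (2 - (1 + β) * s) = K := by rw [hβs]; ring
    simp only [Pi.add_apply, Finset.sum_const, nsmul_eq_mul, mul_one, h3]
    exact (abs_sub_le _ _ _).trans (add_le_add h1 le_rfl)
  · rw [integral_const_mul, integral_add' hA.1 hB.1]
    calc 4 / (K : ℝ) * _ ≤ 4 / (K : ℝ) * (√n + √n) :=
          mul_le_mul_of_nonneg_left (add_le_add hA.2 hB.2) (by positivity)
      _ = 16 / √n := by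
        have hn0 : (0 : ℝ) < n := by linarith
        have h5 : √(n : ℝ) ^ 2 = 2 * K := by rw [Real.sq_sqrt hn0.le, hn]
        have h6 : 0 < √(n : ℝ) := Real.sqrt_pos.2 hn0
        field_simp
        linarith

/-- The dominating `Y` is the head count error plus the error of the utility sum above the
threshold. It is used twice, for the given `β` and for `β = 1`. -/
theorem utility_stableAlg_deviation (hcard : ∀ j, (groupMembers group j).card = ∑ ℓ, k ℓ)
    (hβ : 0 < β) (hβ1 : β ≤ 1) :
    ∃ Y : (Fin n → ℝ) → ℝ, Integrable Y (Measure.pi fun _ => uniform01) ∧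
      ∫ u, Y u ∂(Measure.pi fun _ => uniform01) ≤ 2 * √n ∧
      ∀ u, (∀ i, u i ∈ Set.Icc (0 : ℝ) 1) → ∀ σ : Fin n → Pref p,
        |utility u (stableAlg k (estimated group β u) σ)
          - (∑ ℓ, k ℓ : ℕ) * (1 / 2 + β / (1 + β) ^ 2)| ≤ Y u := by
  set K := ∑ ℓ, k ℓ with hKdef
  have hKn : K ≤ n := total_capacity_le hcard
  set s := 1 / (1 + β) with hs
  have hs0 : 0 ≤ s := by positivity
  have hs1 : s ≤ 1 := by rw [hs, div_le_one (by positivity)]; linarith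
  have hβs : (1 + β) * s = 1 := by rw [hs]; field_simp
  have hA := integral_abs_sum_cutoff_sub_le group hβ (W := fun _ _ => (1 : ℝ)) (s := s)
    (fun i => measurable_const) (fun i x _ => by simp)
    (sum_integral_cutoff_one hcard hβ hβ1 hs0 hs1)
  have hB := integral_abs_sum_cutoff_sub_le group hβ (W := fun _ x => x) (s := s)
    (fun i => measurable_id) (fun i x hx => hx)
    (sum_integral_cutoff_id hcard hβ hβ1 hs0 hs1)
  refine ⟨_, hA.1.add hB.1, ?_, ?_⟩
  · rw [integral_add' hA.1 hB.1]
    linarith [hA.2, hB.2]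
  · intro u hu σ
    have h1 := abs_sum_selected_sub_le k σ (estimated group β u) hKn (β * s) (w := u) hu
    rw [← hKdef] at h1
    have h3 : (K : ℝ) * (2 - (1 + β) * s) = K := by rw [hβs]; ring
    have h4 : (K : ℝ) * (1 / 2 + β / (1 + β) ^ 2) = K * ((2 - s ^ 2 - (β * s) ^ 2) / 2) := by
      rw [hs]; field_simp; ring
    simp only [Pi.add_apply, Finset.sum_const, nsmul_eq_mul, mul_one, h3]
    rw [h4]
    exact (abs_sub_le _ _ _).trans (add_le_add h1 le_rfl)

theorem measurable_comp_stableAlg {α : Type*} [MeasurableSpace α] (k : Fin p → ℕ)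
    {v : α → Fin n → ℝ} (hv : Measurable v) {τ : α → Fin n → Pref p} (hτ : Measurable τ)
    (F : (Fin n → Pref p) → Selection n p → ℝ) :
    Measurable fun a => F (τ a) (stableAlg k (v a) (τ a)) := by
  let H : Equiv.Perm (Fin n) × (Fin n → Pref p) → ℝ := fun y =>
    F y.2 ((List.ofFn y.1).foldl (serveCandidate k y.2) (fun _ => none))
  have hH : Measurable H := measurable_of_finite H
  exact hH.comp ((measurable_decreasingOrder.comp hv).prodMk hτ)

theorem measurable_utility_stableAlg {α : Type*} [MeasurableSpace α] (k : Fin p → ℕ)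
    {u v : α → Fin n → ℝ} (hu : Measurable u) (hv : Measurable v) {τ : α → Fin n → Pref p}
    (hτ : Measurable τ) :
    Measurable fun a => utility (u a) (stableAlg k (v a) (τ a)) := by
  have : ∀ a, utility (u a) (stableAlg k (v a) (τ a)) =
      ∑ i, (if (stableAlg k (v a) (τ a) i).isSome then (1 : ℝ) else 0) * u a i := by
    intro a; simp [utility, Finset.sum_filter]
  simp only [this]
  exact Finset.measurable_sum _ fun i _ => (measurable_comp_stableAlg k hv hτ
    (fun _ M => if (M i).isSome then (1 : ℝ) else 0)).mul ((measurable_pi_apply i).comp hu)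

/-- Selecting the candidates of largest latent utility maximizes the total utility. -/
theorem utility_stableAlg_le (hKn : ∑ ℓ, k ℓ ≤ n) (v u : Fin n → ℝ) (σ : Fin n → Pref p) :
    utility u (stableAlg k v σ) ≤ utility u (stableAlg k u σ) := by
  classical
  set A := Finset.univ.filter (fun i => (stableAlg k v σ i).isSome)
  set B := Finset.univ.filter (fun i => (stableAlg k u σ i).isSome) with hB
  have hcard : (A \ B).card = (B \ A).card :=
    Finset.card_sdiff_comm ((card_selected k σ v hKn).trans (card_selected k σ u hKn).symm)
  have hle : ∀ a ∈ A \ B, ∀ b ∈ B \ A, u a ≤ u b := by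
    intro a ha b hb
    have ha' := (Finset.mem_sdiff.1 ha).2
    have hb' := (Finset.mem_sdiff.1 hb).1
    rw [hB, filter_isSome_stableAlg k σ u hKn, Finset.mem_filter] at ha' hb'
    have : rank u b < rank u a := by
      rw [Fin.lt_def]; simp only [Finset.mem_univ, true_and] at ha' hb'; omega
    rcases (rank_lt_iff u b a).1 this with h | h
    · exact h.le
    · exact h.1.ge
  have hdiff : ∑ i ∈ A \ B, u i ≤ ∑ i ∈ B \ A, u i := by
    rcases (B \ A).eq_empty_or_nonempty with h | h
    · rw [h, Finset.card_empty, Finset.card_eq_zero] at hcard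
      rw [h, hcard]
    · obtain ⟨b, hb, hmin⟩ := (B \ A).exists_min_image u h
      calc ∑ i ∈ A \ B, u i ≤ (A \ B).card • u b := Finset.sum_le_card_nsmul _ _ _
            fun a ha => hle a ha b hb
        _ = (B \ A).card • u b := by rw [hcard]
        _ ≤ ∑ i ∈ B \ A, u i := Finset.card_nsmul_le_sum _ _ _ hmin
  have h1 := Finset.sum_inter_add_sum_sdiff A B u
  have h2 := Finset.sum_inter_add_sum_sdiff B A u
  rw [Finset.inter_comm] at h2
  change ∑ i ∈ A, u i ≤ ∑ i ∈ B, u i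
  linarith

theorem abs_utilityRatio_sub_le (hp : 0 < p) (hk : ∀ ℓ, 1 ≤ k ℓ)
    (hcard : ∀ j, (groupMembers group j).card = ∑ ℓ, k ℓ) (hβ : 0 < β) (hβ1 : β ≤ 1)
    (L : Measure (Pref p)) [IsProbabilityMeasure L] :
    |utilityRatio uniform01 L group β (∑ ℓ, k ℓ) (stableAlg k)
      - (2 / 3 + 4 * β / (3 * (β + 1) ^ 2))| ≤ 16 / √n := by
  have hK : (0 : ℝ) < (∑ ℓ, k ℓ : ℕ) := by exact_mod_cast total_capacity_pos hp hk
  have hn : (n : ℝ) = 2 * (∑ ℓ, k ℓ : ℕ) := eq_two_mul_of_card hcard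
  have hKn : ∑ ℓ, k ℓ ≤ n := total_capacity_le hcard
  obtain ⟨Y, hYi, hY, hYu⟩ := utility_stableAlg_deviation (p := p) hcard hβ hβ1
  obtain ⟨Z, hZi, hZ, hZu⟩ := utility_stableAlg_deviation (p := p) (β := 1) hcard one_pos le_rfl
  simp only [utilityRatio]
  have htop : ∀ x : (Fin n → ℝ) × (Fin n → Pref p),
      topUtility (∑ ℓ, k ℓ) x.1 = utility x.1 (stableAlg k x.1 x.2) :=
    fun x => topUtility_eq_utility k x.2 x.1 hKn
  simp only [htop]
  set K := ∑ ℓ, k ℓ with hKdef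
  have hmeas : AEStronglyMeasurable (fun x : (Fin n → ℝ) × (Fin n → Pref p) =>
      utility x.1 (stableAlg k (estimated group β x.1) x.2) / utility x.1 (stableAlg k x.1 x.2))
      (populationLaw n uniform01 L) :=
    ((measurable_utility_stableAlg k measurable_fst
      ((measurable_estimated group β).comp measurable_fst) measurable_snd).div
      (measurable_utility_stableAlg k measurable_fst measurable_fst
        measurable_snd)).aestronglyMeasurable
  refine (abs_integral_populationLaw_sub_le L hmeas
    ((hYi.add hZi).const_mul (4 / (3 * (K : ℝ)))) ?_).trans ?_
  · intro u hu σ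
    have h1 := hYu u hu σ
    have h2 := hZu u hu σ
    rw [estimated_one] at h2
    have h3 := utility_stableAlg_le hKn (estimated group β u) u σ
    have h0 : 0 ≤ utility u (stableAlg k (estimated group β u) σ) :=
      Finset.sum_nonneg fun i _ => (hu i).1
    simp only [Pi.add_apply]
    set S := utility u (stableAlg k (estimated group β u) σ)
    set T := utility u (stableAlg k u σ)
    set r := S / T with hr
    have hr0 : 0 ≤ r := div_nonneg h0 (h0.trans h3)
    have hr1 : r ≤ 1 := div_le_one_of_le₀ h3 (h0.trans h3)
    -- This also holds when `T = 0`, since then `S = 0`.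
    have hS : S = r * T := by
      rcases (h0.trans h3).eq_or_lt with h | h
      · rw [← h, mul_zero]; exact le_antisymm (h ▸ h3) h0
      · rw [hr, div_mul_cancel₀ _ h.ne']
    -- The terms `S` and `r * T` cancel. Since `0 ≤ r ≤ 1`, the error of the ratio is linear in the
    -- two deviations, and no lower bound on the random denominator is needed.
    have e1 : r - (2 / 3 + 4 * β / (3 * (β + 1) ^ 2)) = 4 / (3 * (K : ℝ)) *
        ((S - K * (1 / 2 + β / (1 + β) ^ 2)) - r * (T - K * (1 / 2 + 1 / (1 + 1) ^ 2))) := by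
      rw [hS]
      have : β + 1 ≠ 0 := by positivity
      have : 1 + β ≠ 0 := by positivity
      field_simp
      ring
    rw [e1, abs_mul, abs_of_pos (by positivity : (0 : ℝ) < 4 / (3 * K))]
    refine mul_le_mul_of_nonneg_left ?_ (by positivity)
    refine (abs_sub _ _).trans (add_le_add h1 ?_)
    rw [abs_mul, abs_of_nonneg hr0]
    exact (mul_le_of_le_one_left (abs_nonneg _) hr1).trans h2
  · rw [integral_const_mul, integral_add' hYi hZi]
    have hn0 : (0 : ℝ) < n := by linarith
    have h5 : √(n : ℝ) ^ 2 = 2 * K := by rw [Real.sq_sqrt hn0.le, hn]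
    have h6 : 0 < √(n : ℝ) := Real.sqrt_pos.2 hn0
    calc 4 / (3 * (K : ℝ)) * _ ≤ 4 / (3 * (K : ℝ)) * (2 * √n + 2 * √n) :=
          mul_le_mul_of_nonneg_left (add_le_add hY hZ) (by positivity)
      _ = (32 / 3) / √n := by
        field_simp
        linarith
      _ ≤ 16 / √n := by gcongr; norm_num

end metrics

/-! ### Shares of the advantaged top choices and exchangeability -/

open Classical in
/-- The advantaged candidates other than `i`. -/
def others {n : ℕ} (group : Fin n → Fin 2) (i : Fin n) : Finset (Fin n) :=
  {j | j ≠ i ∧ group j = 0}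

open Classical in
/-- The reciprocal of the number of advantaged candidates other than `i` that get their top choice,
if `i` gets its top choice and some other advantaged candidate has latent utility at least `m`. -/
def share {n p : ℕ} (group : Fin n → Fin 2) (m : ℝ) (i : Fin n) (u : Fin n → ℝ)
    (σ : Fin n → Pref p) (M : Selection n p) : ℝ :=
  if ∃ j ∈ others group i, m ≤ u j then
    (if GetsTop σ M i then (1 : ℝ) / ((others group i).filter (GetsTop σ M)).card else 0) else 0

theorem share_mem_Icc {n p : ℕ} (group : Fin n → Fin 2) (m : ℝ) (i : Fin n) (u : Fin n → ℝ)
    (σ : Fin n → Pref p) (M : Selection n p) : share group m i u σ M ∈ Set.Icc (0 : ℝ) 1 := by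
  unfold share
  split_ifs
  -- An empty count gives `1 / 0 = 0`, so the bound by one has no exception.
  · refine ⟨by positivity, ?_⟩
    rw [one_div]
    exact Nat.cast_inv_le_one _
  all_goals simp

theorem measurable_share {n p : ℕ} {α : Type*} [MeasurableSpace α] (k : Fin p → ℕ)
    (group : Fin n → Fin 2) (m : ℝ) (i : Fin n)
    {u v : α → Fin n → ℝ} (hu : Measurable u) (hv : Measurable v) {τ : α → Fin n → Pref p}
    (hτ : Measurable τ) :
    Measurable fun a => share group m i (u a) (τ a) (stableAlg k (v a) (τ a)) := by
  classical
  unfold share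
  refine Measurable.ite ?_ ?_ measurable_const
  · have : {a | ∃ j ∈ others group i, m ≤ u a j} = ⋃ j ∈ others group i, {a | m ≤ u a j} := by
      ext a; simp
    rw [this]
    exact Finset.measurableSet_biUnion _ fun j _ =>
      measurableSet_le measurable_const ((measurable_pi_apply j).comp hu)
  · exact measurable_comp_stableAlg k hv hτ (fun σ M => if GetsTop σ M i then
      (1 : ℝ) / ((others group i).filter (GetsTop σ M)).card else 0)

section equivariance

variable {n p : ℕ}

/-- Without ties the serving order is determined by the values, so it moves along with the
relabelling. -/
theorem stableAlg_comp_perm (k : Fin p → ℕ) (σ : Fin n → Pref p) {v : Fin n → ℝ}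
    (hv : Function.Injective v) (e : Equiv.Perm (Fin n)) :
    stableAlg k (v ∘ e) (σ ∘ e) = stableAlg k v σ ∘ e := by
  classical
  symm
  apply IsServed.eq_stableAlg
  intro i
  have hB : ∀ j, Before (v ∘ e) j i ↔ Before v (e j) (e i) := by
    intro j
    simp only [Before, Function.comp]
    refine or_congr_right ⟨?_, ?_⟩
    · rintro ⟨h1, h2⟩
      exact absurd (e.injective (hv h1)) h2.ne
    · rintro ⟨h1, h2⟩
      exact absurd (hv h1) h2.ne
  rw [Function.comp, isServed_stableAlg k σ v (e i)]
  congr 1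
  ext ℓ
  simp only [openAt, Finset.mem_filter, Finset.mem_univ, true_and, hB, Function.comp]
  have : (Finset.univ.filter (fun j => Before v (e j) (e i) ∧ stableAlg k v σ (e j) = some ℓ)).card
      = (Finset.univ.filter (fun j => Before v j (e i) ∧ stableAlg k v σ j = some ℓ)).card :=
    Finset.card_equiv e (by simp)
  rw [this]

theorem share_comp_perm {group : Fin n → Fin 2} (m : ℝ) (i : Fin n) (u : Fin n → ℝ)
    (σ : Fin n → Pref p) (M : Selection n p) {e : Equiv.Perm (Fin n)}
    (he : ∀ j, group (e j) = group j) :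
    share group m i (u ∘ e) (σ ∘ e) (M ∘ e) = share group m (e i) u σ M := by
  classical
  have hmem : ∀ j, j ∈ others group i ↔ e j ∈ others group (e i) := by
    intro j; simp [others, he]
  have h1 : (∃ j ∈ others group i, m ≤ (u ∘ e) j) ↔ ∃ j ∈ others group (e i), m ≤ u j := by
    simp only [hmem]
    exact e.exists_congr_left.trans (by simp)
  have hg : ∀ j, GetsTop (σ ∘ e) (M ∘ e) j ↔ GetsTop σ M (e j) := fun j => Iff.rfl
  have h2 : ((others group i).filter (GetsTop (σ ∘ e) (M ∘ e))).card
      = ((others group (e i)).filter (GetsTop σ M)).card :=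
    Finset.card_equiv e (fun j => by
      rw [Finset.mem_filter, Finset.mem_filter, hmem, hg])
  unfold share
  rw [h2]
  simp only [h1, hg]

end equivariance

section exchangeable

variable {n p : ℕ} {k : Fin p → ℕ} {group : Fin n → Fin 2} {β m : ℝ}

instance isProbabilityMeasure_populationLaw (D : Measure ℝ) [IsProbabilityMeasure D]
    (L : Measure (Pref p)) [IsProbabilityMeasure L] :
    IsProbabilityMeasure (populationLaw n D L) := by
  unfold populationLaw; infer_instance

/-- The share of candidate `i` under the stable assignment, if its latent utility is below `m`. -/
def lowShare (k : Fin p → ℕ) (group : Fin n → Fin 2) (β m : ℝ) (i : Fin n)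
    (x : (Fin n → ℝ) × (Fin n → Pref p)) : ℝ :=
  if x.1 i < m then share group m i x.1 x.2 (stableAlg k (estimated group β x.1) x.2) else 0

theorem lowShare_mem_Icc (i : Fin n) (x : (Fin n → ℝ) × (Fin n → Pref p)) :
    lowShare k group β m i x ∈ Set.Icc (0 : ℝ) 1 := by
  unfold lowShare
  split_ifs
  · exact share_mem_Icc _ _ _ _ _ _
  · simp

theorem measurable_lowShare (i : Fin n) : Measurable (lowShare k group β m i) :=
  Measurable.ite (measurableSet_lt (by fun_prop) measurable_const)
    (measurable_share k group m i measurable_fst ((measurable_estimated group β).comp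
      measurable_fst) measurable_snd) measurable_const

theorem integrable_lowShare (L : Measure (Pref p)) [IsProbabilityMeasure L] (i : Fin n) :
    Integrable (lowShare k group β m i) (populationLaw n uniform01 L) :=
  Integrable.of_mem_Icc 0 1 (measurable_lowShare i).aemeasurable
    (ae_of_all _ (lowShare_mem_Icc i))

theorem ae_populationLaw_of_ae (L : Measure (Pref p)) [IsProbabilityMeasure L]
    {P : (Fin n → ℝ) → Prop} (h : ∀ᵐ u ∂(Measure.pi fun _ => uniform01), P u) :
    ∀ᵐ x ∂(populationLaw n uniform01 L), P x.1 := by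
  unfold populationLaw
  exact Measure.quasiMeasurePreserving_fst.ae h

/-- The transposition of `i` and `j` preserves both the groups and the population law. -/
theorem integral_lowShare_congr (hβ : 0 < β) (L : Measure (Pref p)) [IsProbabilityMeasure L]
    {i j : Fin n} (hij : group i = group j) :
    ∫ x, lowShare k group β m i x ∂(populationLaw n uniform01 L)
      = ∫ x, lowShare k group β m j x ∂(populationLaw n uniform01 L) := by
  set e : Equiv.Perm (Fin n) := Equiv.swap i j with he
  have hge : ∀ a, group (e a) = group a := by
    intro a
    rw [he, Equiv.swap_apply_def]
    split_ifs with h1 h2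
    · rw [h1, hij]
    · rw [h2, hij]
    · rfl
  have hmp : MeasurePreserving
      (fun x : (Fin n → ℝ) × (Fin n → Pref p) => ((fun a => x.1 (e a)), (fun a => x.2 (e a))))
      (populationLaw n uniform01 L) (populationLaw n uniform01 L) := by
    unfold populationLaw
    exact (measurePreserving_comp_perm uniform01 e).prod (measurePreserving_comp_perm L e)
  have h1 := integral_map (μ := populationLaw n uniform01 L) (f := lowShare k group β m i)
    hmp.measurable.aemeasurable (measurable_lowShare i).aestronglyMeasurable
  rw [hmp.map_eq] at h1
  rw [h1]
  refine integral_congr_ae ?_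
  filter_upwards [ae_populationLaw_of_ae L (ae_injective_estimated group hβ)] with x hx
  have hest : estimated group β (fun a => x.1 (e a)) = estimated group β x.1 ∘ e := by
    ext a; simp [estimated, hge]
  have hei : e i = j := by simp [he]
  have h2 := share_comp_perm m i x.1 x.2 (stableAlg k (estimated group β x.1) x.2) hge
  rw [← stableAlg_comp_perm k x.2 hx e] at h2
  simp only [lowShare, hest, hei]
  rw [hei] at h2
  split_ifs
  · exact h2
  · rfl

/-- Let `T` be the set of advantaged candidates with their top choice. Each member's share is at
most `1 / (|T| - 1)`, so one member must be shown to contribute nothing. If some advantaged latent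
utility is at least `m > β`, the candidate served first is advantaged, gets its top choice and has
utility at least `m`; its `lowShare` vanishes, leaving at most `|T| - 1` terms. -/
theorem sum_lowShare_le_one (hp : 0 < p) (hk : ∀ ℓ, 1 ≤ k ℓ) (hβ : 0 < β) (hβm : β < m)
    {u : Fin n → ℝ} (hu : ∀ i, u i ∈ Set.Icc (0 : ℝ) 1) (σ : Fin n → Pref p) :
    ∑ i with group i = 0, lowShare k group β m i (u, σ) ≤ 1 := by
  classical
  set M := stableAlg k (estimated group β u) σ with hM
  by_cases hex : ∃ j, group j = 0 ∧ m ≤ u j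
  · obtain ⟨j, hj0, hj⟩ := hex
    obtain ⟨a, -, ha⟩ := Finset.univ.exists_min_image (rank (estimated group β u)) ⟨j, Finset.mem_univ j⟩
    have htop : GetsTop σ M a := getsTop_of_forall_not_before hp hk σ _ a fun b hb =>
      not_lt.2 (ha b (Finset.mem_univ b)) ((rank_lt_iff _ _ _).2 hb)
    have hja : estimated group β u j ≤ estimated group β u a := by
      by_contra hn
      exact not_lt.2 (ha j (Finset.mem_univ j)) ((rank_lt_iff _ _ _).2 (Or.inl (not_le.1 hn)))
    have hej : estimated group β u j = u j := by simp [estimated, hj0]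
    have ha0 : group a = 0 := by
      by_contra hn
      have : group a = 1 := by omega
      have h2 : estimated group β u a = β * u a := by simp [estimated, this]
      have := (hu a).2
      nlinarith
    have hea : estimated group β u a = u a := by simp [estimated, ha0]
    set T := Finset.univ.filter (fun i => group i = 0 ∧ GetsTop σ M i) with hT
    have haT : a ∈ T := by simp [hT, ha0, htop]
    have hle : ∀ i, group i = 0 → lowShare k group β m i (u, σ)
        ≤ if i ∈ T.erase a then 1 / ((T.erase a).card : ℝ) else 0 := by
      intro i hi
      simp only [lowShare, share]
      split_ifs with h1 h2 h3 h4 h5 <;> try positivity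
      · have h6 : (others group i).filter (GetsTop σ M) = T.erase i := by
          ext b; simp [others, hT, and_assoc]
        have hiT : i ∈ T := by simp only [hT, Finset.mem_filter, Finset.mem_univ, true_and, hi]; exact h3
        rw [← hM, h6, Finset.card_erase_of_mem hiT, Finset.card_erase_of_mem haT]
      · exfalso
        apply h4
        -- The first candidate has latent utility at least `m`, whereas `h1` puts that of `i` below
        -- `m`.
        have hia : i ≠ a := by
          rintro rfl
          linarith
        simp [hia, hT, hi]
        exact h3
    calc ∑ i with group i = 0, lowShare k group β m i (u, σ)
        ≤ ∑ i with group i = 0, (if i ∈ T.erase a then 1 / ((T.erase a).card : ℝ) else 0) :=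
          Finset.sum_le_sum fun i hi => hle i (Finset.mem_filter.1 hi).2
      _ ≤ ∑ i, (if i ∈ T.erase a then 1 / ((T.erase a).card : ℝ) else 0) :=
          Finset.sum_le_sum_of_subset_of_nonneg (Finset.filter_subset _ _)
            fun i _ _ => by split_ifs <;> positivity
      _ = (T.erase a).card * (1 / ((T.erase a).card : ℝ)) := by
          rw [← Finset.sum_filter, Finset.sum_const, nsmul_eq_mul, Finset.filter_univ_mem]
      _ ≤ 1 := by rw [mul_one_div]; exact div_self_le_one _
  · have : ∀ i, lowShare k group β m i (u, σ) = 0 := by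
      intro i
      have : ¬ ∃ j ∈ others group i, m ≤ u j := by
        rintro ⟨j, hj, hj'⟩
        exact hex ⟨j, by simp only [others, Finset.mem_filter] at hj; exact hj.2.2, hj'⟩
      simp [lowShare, share, this]
    simp [this]

theorem card_mul_integral_lowShare_le (hp : 0 < p) (hk : ∀ ℓ, 1 ≤ k ℓ) (hβ : 0 < β) (hβm : β < m)
    (L : Measure (Pref p)) [IsProbabilityMeasure L] {i : Fin n} (hi : group i = 0) :
    (groupMembers group 0).card * ∫ x, lowShare k group β m i x ∂(populationLaw n uniform01 L)
      ≤ 1 := by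
  have h1 : ∑ j ∈ groupMembers group 0,
      ∫ x, lowShare k group β m j x ∂(populationLaw n uniform01 L)
      = (groupMembers group 0).card *
        ∫ x, lowShare k group β m i x ∂(populationLaw n uniform01 L) := by
    rw [← nsmul_eq_mul, ← Finset.sum_const]
    refine Finset.sum_congr rfl fun j hj => integral_lowShare_congr hβ L ?_
    rw [hi]; exact (Finset.mem_filter.1 hj).2
  rw [← h1, ← integral_finsetSum _ fun j _ => integrable_lowShare L j]
  have : ∫ _x, (1 : ℝ) ∂(populationLaw n uniform01 L) = 1 := by simp
  rw [← this]
  refine integral_mono_ae (integrable_finsetSum _ fun j _ => integrable_lowShare L j)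
    (integrable_const _) ?_
  filter_upwards [ae_populationLaw_of_ae L (ae_mem_pi_uniform01 n)] with x hx
  exact sum_lowShare_le_one hp hk hβ hβm hx x.2

end exchangeable

/-! ### Moving one disadvantaged candidate to the advantaged group -/

section comparison

variable {n p : ℕ} {k : Fin p → ℕ} {group : Fin n → Fin 2} {β m s : ℝ}

/-- The share of candidate `i` under the stable assignment, if its estimated utility is at least
`t`. -/
def highShare (k : Fin p → ℕ) (group : Fin n → Fin 2) (β m t : ℝ) (i : Fin n)
    (x : (Fin n → ℝ) × (Fin n → Pref p)) : ℝ :=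
  if t ≤ β * x.1 i then share group m i x.1 x.2 (stableAlg k (estimated group β x.1) x.2) else 0

theorem highShare_mem_Icc {t : ℝ} (i : Fin n) (x : (Fin n → ℝ) × (Fin n → Pref p)) :
    highShare k group β m t i x ∈ Set.Icc (0 : ℝ) 1 := by
  unfold highShare
  split_ifs
  · exact share_mem_Icc _ _ _ _ _ _
  · simp

theorem measurable_highShare {t : ℝ} (i : Fin n) : Measurable (highShare k group β m t i) :=
  Measurable.ite (measurableSet_le measurable_const (by fun_prop))
    (measurable_share k group m i measurable_fst ((measurable_estimated group β).comp
      measurable_fst) measurable_snd) measurable_const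

theorem integrable_highShare {t : ℝ} (L : Measure (Pref p)) [IsProbabilityMeasure L]
    (i : Fin n) :
    Integrable (highShare k group β m t i) (populationLaw n uniform01 L) :=
  Integrable.of_mem_Icc 0 1 (measurable_highShare i).aemeasurable
    (ae_of_all _ (highShare_mem_Icc i))

/-- The share is zero until `i` gets its top choice; from then on the assignment is frozen and the
share constant. -/
theorem monotone_share_update (k : Fin p → ℕ) (group : Fin n → Fin 2) (m : ℝ) (i : Fin n)
    (u v : Fin n → ℝ) (σ : Fin n → Pref p) :
    Monotone fun x => share group m i u σ (stableAlg k (Function.update v i x) σ) := by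
  intro x y hxy
  by_cases h : GetsTop σ (stableAlg k (Function.update v i x) σ) i
  · simp only [stableAlg_update_of_getsTop k σ v i hxy h, le_refl]
  · have : share group m i u σ (stableAlg k (Function.update v i x) σ) = 0 := by
      simp [share, h]
    simp only [this]
    exact (share_mem_Icc _ _ _ _ _ _).1

theorem others_update (i : Fin n) (j : Fin 2) :
    others (Function.update group i j) i = others group i := by
  ext a
  simp only [others, Finset.mem_filter, Finset.mem_univ, true_and]
  refine and_congr_right fun h => ?_
  rw [Function.update_of_ne h]

theorem share_update (i : Fin n) (j : Fin 2) (u : Fin n → ℝ) (y : ℝ) (σ : Fin n → Pref p)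
    (M : Selection n p) :
    share (Function.update group i j) m i (Function.update u i y) σ M = share group m i u σ M := by
  have : (∃ j ∈ others group i, m ≤ Function.update u i y j) ↔ ∃ j ∈ others group i, m ≤ u j := by
    refine exists_congr fun a => and_congr_right fun h => ?_
    simp only [others, Finset.mem_filter] at h
    rw [Function.update_of_ne h.2.1]
  simp only [share, others_update, this]

theorem estimated_update (i : Fin n) (j : Fin 2) (u : Fin n → ℝ) (y : ℝ) :
    estimated (Function.update group i j) β (Function.update u i y)
      = Function.update (estimated group β u) i (if j = 1 then β * y else y) := by
  ext a
  by_cases h : a = i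
  · subst h; simp [estimated]
  · simp [estimated, h]

theorem integral_pi_update {g : (Fin n → ℝ) → ℝ} (hg : Measurable g)
    (h01 : ∀ u, g u ∈ Set.Icc (0 : ℝ) 1) (i : Fin n) :
    ∫ u, g u ∂(Measure.pi fun _ => uniform01)
      = ∫ u, ∫ y, g (Function.update u i y) ∂uniform01 ∂(Measure.pi fun _ => uniform01) ∧
    Integrable (fun u => ∫ y, g (Function.update u i y) ∂uniform01)
      (Measure.pi fun _ => uniform01) := by
  have hmp := measurePreserving_update uniform01 i
  have hi : Integrable (fun z : (Fin n → ℝ) × ℝ => g (Function.update z.1 i z.2))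
      ((Measure.pi fun _ => uniform01).prod uniform01) :=
    Integrable.of_mem_Icc 0 1 (hg.comp hmp.measurable).aemeasurable (ae_of_all _ fun z => h01 _)
  refine ⟨?_, hi.integral_prod_left⟩
  have h1 := integral_map (μ := (Measure.pi fun _ => uniform01).prod uniform01) (f := g)
    hmp.measurable.aemeasurable hg.aestronglyMeasurable
  rw [hmp.map_eq] at h1
  rw [h1, integral_prod _ hi]

/-- Moving a disadvantaged candidate to the advantaged group increases its expected share. -/
theorem integral_highShare_le (hβ : 0 < β) (hβm : β ≤ m) (hm1 : m ≤ 1) (hs0 : 0 ≤ s) (hs1 : s < 1)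
    (L : Measure (Pref p)) [IsProbabilityMeasure L] {i : Fin n} (hi : group i = 1) :
    ∫ x, highShare k group β m (β * s) i x ∂(populationLaw n uniform01 L)
      ≤ (1 - s) / (m - β * s) *
        ∫ x, lowShare k (Function.update group i 0) β m i x ∂(populationLaw n uniform01 L) := by
  have hgi : Function.update group i 1 = group := by rw [← hi, Function.update_eq_self]
  have hsβ : β * s < β := by nlinarith
  have hconst : (β - β * s) / (β * (m - β * s)) = (1 - s) / (m - β * s) := by
    rw [← mul_one_sub, mul_div_mul_left _ _ hβ.ne']
  have hc0 : 0 ≤ (1 - s) / (m - β * s) := div_nonneg (by linarith) (by linarith)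
  have key : ∀ σ : Fin n → Pref p,
      ∫ u, highShare k group β m (β * s) i (u, σ) ∂(Measure.pi fun _ => uniform01)
      ≤ (1 - s) / (m - β * s) * ∫ u, lowShare k (Function.update group i 0) β m i (u, σ)
        ∂(Measure.pi fun _ => uniform01) := by
    intro σ
    have h1 := integral_pi_update (g := fun u => highShare k group β m (β * s) i (u, σ))
      ((measurable_highShare i).comp measurable_prodMk_right) (fun u => highShare_mem_Icc i _) i
    have h2 := integral_pi_update
      (g := fun u => lowShare k (Function.update group i 0) β m i (u, σ))
      ((measurable_lowShare i).comp measurable_prodMk_right) (fun u => lowShare_mem_Icc i _) i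
    rw [h1.1, h2.1, ← integral_const_mul]
    refine integral_mono h1.2 (h2.2.const_mul _) fun u => ?_
    -- Since `others` ignores the group of `i`, both instances use the same function `φ` of the
    -- estimated utility of `i`. Only the argument differs: `β * y` in the original, `y` after the
    -- move.
    set φ : ℝ → ℝ := fun x =>
      share group m i u σ (stableAlg k (Function.update (estimated group β u) i x) σ) with hφ
    have hmono : Monotone φ := monotone_share_update k group m i u _ σ
    have hH : ∀ y, highShare k group β m (β * s) i (Function.update u i y, σ)
        = {y | β * s ≤ β * y}.indicator (fun y => φ (β * y)) y := by
      intro y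
      have e1 := estimated_update (group := group) (β := β) i 1 u y
      have e2 := share_update (group := group) (m := m) i 1 u y σ
        (stableAlg k (Function.update (estimated group β u) i (β * y)) σ)
      rw [hgi] at e1 e2
      rw [if_pos rfl] at e1
      simp only [highShare, Function.update_self, Set.indicator_apply, Set.mem_ofPred_eq, hφ, e1, e2]
    have hlow : ∀ y, (Set.Ico (β * s) m).indicator φ y
        ≤ lowShare k (Function.update group i 0) β m i (Function.update u i y, σ) := by
      intro y
      rw [Set.indicator_apply]
      split_ifs with h
      · have e1 := estimated_update (group := group) (β := β) i 0 u y
        rw [if_neg (by decide)] at e1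
        simp only [lowShare, Function.update_self, if_pos h.2, e1, share_update, hφ, le_refl]
      · exact (lowShare_mem_Icc i _).1
    simp only [hH]
    refine (hmono.integral_rescale_le hβ (by positivity) hsβ hβm hm1).trans ?_
    rw [hconst]
    refine mul_le_mul_of_nonneg_left (integral_mono ?_ ?_ hlow) hc0
    · exact Integrable.of_mem_Icc 0 1 (hmono.measurable.indicator measurableSet_Ico).aemeasurable
        (ae_of_all _ fun y => by
          rw [Set.indicator_apply]
          split_ifs
          · exact share_mem_Icc _ _ _ _ _ _
          · simp)
    · refine Integrable.of_mem_Icc 0 1 (Measurable.aemeasurable ?_)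
        (ae_of_all _ fun y => lowShare_mem_Icc i _)
      exact (measurable_lowShare i).comp (((measurePreserving_update uniform01 i).measurable.comp
        measurable_prodMk_left).prodMk measurable_const)
  have hHi := integrable_highShare (k := k) (group := group) (β := β) (m := m) (t := β * s) L i
  have hLi := integrable_lowShare (k := k) (group := Function.update group i 0) (β := β) (m := m)
    L i
  unfold populationLaw at hHi hLi ⊢
  rw [integral_prod_symm _ hHi, integral_prod_symm _ hLi, ← integral_const_mul]
  exact integral_mono hHi.integral_prod_right (hLi.integral_prod_right.const_mul _) key

theorem card_groupMembers_update {K : ℕ} (hcard : ∀ j, (groupMembers group j).card = K) {i : Fin n}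
    (hi : group i = 1) : (groupMembers (Function.update group i 0) 0).card = K + 1 := by
  classical
  have : groupMembers (Function.update group i 0) 0 = insert i (groupMembers group 0) := by
    ext a
    by_cases h : a = i
    · subst h; simp [groupMembers]
    · simp [groupMembers, h]
  rw [this, Finset.card_insert_of_notMem (by simp [groupMembers, hi]), hcard]

/-- The expected total share of the disadvantaged candidates above a threshold. -/
theorem sum_integral_highShare_le (hp : 0 < p) (hk : ∀ ℓ, 1 ≤ k ℓ) {K : ℕ}
    (hcard : ∀ j, (groupMembers group j).card = K)
    (hβ : 0 < β) (hβm : β < m) (hm1 : m ≤ 1) (hs0 : 0 ≤ s) (hs1 : s < 1)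
    (L : Measure (Pref p)) [IsProbabilityMeasure L] :
    ∑ i ∈ groupMembers group 1,
      ∫ x, highShare k group β m (β * s) i x ∂(populationLaw n uniform01 L)
      ≤ (1 - s) / (m - β * s) := by
  have hsβ : β * s < β := by nlinarith
  have hc0 : 0 ≤ (1 - s) / (m - β * s) := div_nonneg (by linarith) (by linarith)
  have h1 : ∀ i ∈ groupMembers group 1,
      ∫ x, highShare k group β m (β * s) i x ∂(populationLaw n uniform01 L)
        ≤ (1 - s) / (m - β * s) * (1 / (K + 1)) := by
    intro i hi
    have hi1 : group i = 1 := (Finset.mem_filter.1 hi).2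
    refine (integral_highShare_le hβ hβm.le hm1 hs0 hs1 L hi1).trans
      (mul_le_mul_of_nonneg_left ?_ hc0)
    have := card_mul_integral_lowShare_le (k := k) hp hk hβ hβm L
      (group := Function.update group i 0) (i := i) (by simp)
    rw [card_groupMembers_update hcard hi1] at this
    rw [le_div_iff₀ (by positivity), mul_comm]
    exact_mod_cast this
  -- There are `K` terms, each with factor `1 / (K + 1)`: the moved candidate enlarges the
  -- advantaged group by one.
  refine (Finset.sum_le_sum h1).trans ?_
  rw [Finset.sum_const, hcard, nsmul_eq_mul, mul_left_comm]
  refine mul_le_of_le_one_right hc0 ?_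
  rw [mul_one_div, div_le_one (by positivity)]
  linarith

end comparison

/-! ### Preference-based fairness -/

/-- The weighted number of candidates above a threshold, for weights `W i` of the latent utility,
has an exponentially small lower tail. -/
theorem measureReal_sum_cutoff_le_le_exp {n : ℕ} (group : Fin n → Fin 2) {β s : ℝ} (hβ : 0 < β)
    {W : Fin n → ℝ → ℝ} (hW : ∀ i, Measurable (W i))
    (h01 : ∀ i, ∀ x ∈ Set.Icc (0 : ℝ) 1, W i x ∈ Set.Icc (0 : ℝ) 1) {m r a : ℝ} (hr : 0 ≤ r)
    (hm : ∑ i, ∫ x, (Set.Ici (cutoff group β s i)).indicator (W i) x ∂uniform01 = m)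
    (ha : a = m - r) :
    MeasurableSet {u | ∑ i with β * s ≤ estimated group β u i, W i (u i) ≤ a} ∧
    (Measure.pi fun _ => uniform01).real
      {u | ∑ i with β * s ≤ estimated group β u i, W i (u i) ≤ a} ≤ Real.exp (-(2 * r ^ 2 / n)) := by
  have hf : ∀ i, Measurable ((Set.Ici (cutoff group β s i)).indicator (W i)) :=
    fun i => (hW i).indicator measurableSet_Ici
  have hf01 : ∀ i, ∀ x ∈ Set.Icc (0 : ℝ) 1,
      (Set.Ici (cutoff group β s i)).indicator (W i) x ∈ Set.Icc (0 : ℝ) 1 := by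
    intro i x hx
    rw [Set.indicator_apply]
    split_ifs
    · exact h01 i x hx
    · simp
  have h1 := measureReal_sum_le_le_exp hf hf01 hr
  have h2 : MeasurableSet {u : Fin n → ℝ |
      ∑ i, (Set.Ici (cutoff group β s i)).indicator (W i) (u i) ≤ a} :=
    measurableSet_le (Finset.measurable_sum _ fun i _ => (hf i).comp (measurable_pi_apply i))
      measurable_const
  rw [hm, ← ha] at h1
  simp only [sum_indicator_cutoff group hβ] at h1 h2
  exact ⟨h2, h1⟩

theorem minMaxRatio_le_div {ρ : Fin 2 → ℝ} (h : ∀ j, 0 ≤ ρ j) : minMaxRatio ρ ≤ ρ 1 / ρ 0 := by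
  unfold minMaxRatio
  rcases (h 0).eq_or_lt with h0 | h0
  -- If `ρ 0 = 0`, both sides are zero.
  · rw [← h0, div_zero, min_eq_left (h 1), zero_div]
  · exact div_le_div₀ (h 1) (min_le_right _ _) h0 (le_max_left _ _)

theorem minMaxRatio_le_one {ρ : Fin 2 → ℝ} (h : ∀ j, 0 ≤ ρ j) : minMaxRatio ρ ≤ 1 :=
  div_le_one_of_le₀ (min_le_max) ((h 0).trans (le_max_left _ _))

section preference

variable {n p : ℕ} {k : Fin p → ℕ} {group : Fin n → Fin 2} {β m s : ℝ}

theorem topChoiceFraction_nonneg (σ : Fin n → Pref p) (M : Selection n p) (j : Fin 2) :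
    0 ≤ topChoiceFraction group σ M j := by
  unfold topChoiceFraction; positivity

/-- With equal group sizes the ratio is a quotient of two counts, written as a sum over its
numerator. Hypothesis `hF` forces every selected candidate above the threshold, and `hE` supplies
the strong advantaged candidate required by `share`. -/
theorem minMaxRatio_topChoiceFraction_le (hp : 0 < p) (hk : ∀ ℓ, 1 ≤ k ℓ)
    (hcard : ∀ j, (groupMembers group j).card = ∑ ℓ, k ℓ) (u : Fin n → ℝ) (σ : Fin n → Pref p)
    (hF : ((∑ ℓ, k ℓ : ℕ) : ℝ) < (Finset.univ.filter (fun i => β * s ≤ estimated group β u i)).card)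
    (hE : ∃ j, group j = 0 ∧ m ≤ u j) :
    minMaxRatio (topChoiceFraction group σ (stableAlg k (estimated group β u) σ))
      ≤ ∑ i ∈ groupMembers group 1, highShare k group β m (β * s) i (u, σ) := by
  classical
  set M := stableAlg k (estimated group β u) σ with hM
  refine (minMaxRatio_le_div (topChoiceFraction_nonneg σ M)).trans ?_
  have hK : (0 : ℝ) < (∑ ℓ, k ℓ : ℕ) := by exact_mod_cast total_capacity_pos hp hk
  have hKn := total_capacity_le hcard
  have hT : ∀ j, topChoiceFraction group σ M j
      = ((groupMembers group j).filter (GetsTop σ M)).card / ((∑ ℓ, k ℓ : ℕ) : ℝ) := by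
    intro j
    rw [topChoiceFraction, hcard]
    congr 3
    ext i
    simp [GetsTop]
  rw [hT, hT, div_div_div_cancel_right₀ hK.ne', div_eq_mul_one_div, ← nsmul_eq_mul,
    ← Finset.sum_const, Finset.sum_filter]
  refine Finset.sum_le_sum fun i hi => ?_
  split_ifs with htop
  · have hi1 : group i = 1 := (Finset.mem_filter.1 hi).2
    -- More than `K` candidates lie above the threshold, so of the two nested sets the selected one
    -- is the smaller.
    have hsub : Finset.univ.filter (fun i => (M i).isSome) ⊆
        Finset.univ.filter (fun i => β * s ≤ estimated group β u i) := by
      rcases selected_subset_or_superset k σ (estimated group β u) hKn (β * s) with h | h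
      · exact h
      · have := Finset.card_le_card h
        rw [card_selected k σ _ hKn] at this
        exact absurd hF (not_lt.2 (by exact_mod_cast this))
    have h1 : β * s ≤ estimated group β u i :=
      (Finset.mem_filter.1 (hsub (Finset.mem_filter.2 ⟨Finset.mem_univ i, htop.isSome⟩))).2
    rw [estimated, if_pos hi1] at h1
    have hoth : others group i = groupMembers group 0 := by
      ext a
      simp only [others, groupMembers, Finset.mem_filter, Finset.mem_univ, true_and,
        and_iff_right_iff_imp]
      rintro h rfl
      omega
    obtain ⟨j, hj0, hj⟩ := hE
    have hex : ∃ j ∈ others group i, m ≤ u j :=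
      ⟨j, by rw [hoth]; exact Finset.mem_filter.2 ⟨Finset.mem_univ _, hj0⟩, hj⟩
    rw [highShare, if_pos h1, share, if_pos hex, if_pos htop, hoth]
  · exact (highShare_mem_Icc i _).1

theorem prefFairness_le_one (L : Measure (Pref p)) [IsProbabilityMeasure L] :
    prefFairness uniform01 L group β (stableAlg k) ≤ 1 := by
  have : ∫ _x, (1 : ℝ) ∂(populationLaw n uniform01 L) = 1 := by simp
  rw [← this]
  exact integral_mono (integrable_stableAlg k group β uniform01 L
    (fun σ M => minMaxRatio (topChoiceFraction group σ M))) (integrable_const _)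
    fun x => minMaxRatio_le_one (topChoiceFraction_nonneg _ _)

theorem integral_indicator_fst_populationLaw (L : Measure (Pref p)) [IsProbabilityMeasure L]
    {A : Set (Fin n → ℝ)} (hA : MeasurableSet A) :
    Integrable (fun x : (Fin n → ℝ) × (Fin n → Pref p) => A.indicator (fun _ => (1 : ℝ)) x.1)
      (populationLaw n uniform01 L) ∧
    ∫ x, A.indicator (fun _ => (1 : ℝ)) x.1 ∂(populationLaw n uniform01 L)
      = (Measure.pi fun _ => uniform01).real A := by
  have hmp : MeasurePreserving Prod.fst (populationLaw n uniform01 L)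
      (Measure.pi fun _ : Fin n => uniform01) := by
    unfold populationLaw; exact measurePreserving_fst
  have hm : Measurable (A.indicator (fun _ => (1 : ℝ))) := measurable_const.indicator hA
  refine ⟨hmp.integrable_comp_of_integrable ((integrable_const _).indicator hA), ?_⟩
  have := integral_map (μ := populationLaw n uniform01 L) (f := A.indicator (fun _ => (1 : ℝ)))
    hmp.measurable.aemeasurable hm.aestronglyMeasurable
  rw [hmp.map_eq] at this
  rw [← this, integral_indicator_const _ hA, smul_eq_mul, mul_one]

/-- Outside two exceptional events the ratio is at most the total `highShare`, and on them it is at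
most one. Each event is a downward deviation by `K * w`, of probability at most `exp (-K w²)`. -/
theorem prefFairness_le_add_exp (hp : 0 < p) (hk : ∀ ℓ, 1 ≤ k ℓ)
    (hcard : ∀ j, (groupMembers group j).card = ∑ ℓ, k ℓ) (hβ : 0 < β) (hβ1 : β ≤ 1)
    (L : Measure (Pref p)) [IsProbabilityMeasure L] {w : ℝ} (hw0 : 0 < w) :
    prefFairness uniform01 L group β (stableAlg k)
      ≤ β + 4 * w + 2 * Real.exp (-((∑ ℓ, k ℓ : ℕ) * w ^ 2)) := by
  set K := ∑ ℓ, k ℓ with hKdef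
  have hK : (0 : ℝ) < K := by exact_mod_cast total_capacity_pos hp hk
  have hn : (n : ℝ) = 2 * K := eq_two_mul_of_card hcard
  have hexp := Real.exp_pos (-((K : ℝ) * w ^ 2))
  -- For `w ≥ 1/4` or `β ≥ 1 - w` the right side is at least one and there is nothing to prove.
  -- Otherwise `m = 1 - w` exceeds `β`.
  rcases le_or_gt (1 / 4) w with hw | hw
  · linarith [prefFairness_le_one (k := k) (group := group) (β := β) L]
  rcases le_or_gt (1 - w) β with hβw | hβw
  · linarith [prefFairness_le_one (k := k) (group := group) (β := β) L]
  set s := (1 - w) / (1 + β) with hs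
  have hs0 : 0 ≤ s := div_nonneg (by linarith) (by linarith)
  have hs1 : s < 1 := by rw [hs, div_lt_one (by positivity)]; linarith
  have hβs : (1 + β) * s = 1 - w := by rw [hs]; field_simp
  have hr : (2 * (K * w) ^ 2 / n : ℝ) = K * w ^ 2 := by rw [hn]; field_simp
  -- The slack `w` in `s` raises the expected head count to `K * (1 + w)`.
  obtain ⟨hAm, hA⟩ := measureReal_sum_cutoff_le_le_exp group hβ (W := fun _ _ => (1 : ℝ)) (s := s)
    (r := K * w) (a := K) (fun i => measurable_const) (fun i x _ => by simp) (by positivity)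
    (sum_integral_cutoff_one hcard hβ hβ1 hs0 hs1.le) (by rw [hβs]; ring)
  -- Taking bias `1` here turns the threshold into one on latent utilities: the event is that no
  -- advantaged candidate reaches `1 - w`, while `K * w` are expected.
  obtain ⟨hBm, hB⟩ := measureReal_sum_cutoff_le_le_exp group one_pos
    (W := fun i _ => if group i = 1 then (0 : ℝ) else 1) (s := 1 - w) (r := K * w) (a := 0)
    (fun i => measurable_const) (fun i x _ => by split_ifs <;> simp) (by positivity)
    (sum_integral_cutoff_group hcard one_pos le_rfl (by linarith) (by linarith)) (by ring)
  rw [hr] at hA hB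
  set A := {u : Fin n → ℝ | ∑ i with β * s ≤ estimated group β u i, (1 : ℝ) ≤ K} with hAdef
  set B := {u : Fin n → ℝ | ∑ i with 1 * (1 - w) ≤ estimated group 1 u i,
    (if group i = 1 then (0 : ℝ) else 1) ≤ 0} with hBdef
  obtain ⟨hAi, hAe⟩ := integral_indicator_fst_populationLaw L hAm
  obtain ⟨hBi, hBe⟩ := integral_indicator_fst_populationLaw L hBm
  have hH := integrable_finsetSum (groupMembers group 1) fun i _ =>
    integrable_highShare (k := k) (group := group) (β := β) (m := 1 - w) (t := β * s) L i
  have hnn : ∀ (S : Set (Fin n → ℝ)) u, 0 ≤ S.indicator (fun _ => (1 : ℝ)) u :=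
    fun S u => Set.indicator_nonneg (fun _ _ => zero_le_one) u
  have hmain : prefFairness uniform01 L group β (stableAlg k)
      ≤ ∫ x, ((A.indicator (fun _ => (1 : ℝ)) x.1 + B.indicator (fun _ => (1 : ℝ)) x.1)
        + ∑ i ∈ groupMembers group 1, highShare k group β (1 - w) (β * s) i x)
        ∂(populationLaw n uniform01 L) := by
    refine integral_mono (integrable_stableAlg k group β uniform01 L
      (fun σ M => minMaxRatio (topChoiceFraction group σ M))) ((hAi.add hBi).add hH) fun x => ?_
    have hsum : 0 ≤ ∑ i ∈ groupMembers group 1, highShare k group β (1 - w) (β * s) i x :=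
      Finset.sum_nonneg fun i _ => (highShare_mem_Icc i x).1
    have hle1 := minMaxRatio_le_one (topChoiceFraction_nonneg (group := group) x.2
      (stableAlg k (estimated group β x.1) x.2))
    have hA0 := hnn A x.1
    have hB0 := hnn B x.1
    simp only
    by_cases hxA : x.1 ∈ A
    · rw [Set.indicator_of_mem hxA]; linarith
    by_cases hxB : x.1 ∈ B
    · rw [Set.indicator_of_mem hxB]; linarith
    have hF : (K : ℝ) < (Finset.univ.filter
        (fun i => β * s ≤ estimated group β x.1 i)).card := by
      simpa [hAdef] using hxA
    have hE : ∃ j, group j = 0 ∧ 1 - w ≤ x.1 j := by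
      by_contra! hcon
      apply hxB
      rw [hBdef, Set.mem_ofPred_eq]
      refine Finset.sum_nonpos fun i hi => ?_
      rw [Finset.mem_filter, one_mul, estimated_one] at hi
      split_ifs with h
      · exact le_rfl
      · exact absurd hi.2 (not_le.2 (hcon i (by omega)))
    have := minMaxRatio_topChoiceFraction_le hp hk hcard x.1 x.2 hF hE
    linarith
  have hshare := sum_integral_highShare_le (k := k) (group := group) hp hk hcard hβ hβw
    (by linarith) hs0 hs1 L
  have hABi : Integrable (fun x : (Fin n → ℝ) × (Fin n → Pref p) =>
      A.indicator (fun _ => (1 : ℝ)) x.1 + B.indicator (fun _ => (1 : ℝ)) x.1)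
      (populationLaw n uniform01 L) := hAi.add hBi
  rw [integral_add hABi hH, integral_add hAi hBi, hAe, hBe,
    integral_finsetSum _ fun i _ => integrable_highShare L i] at hmain
  have hc : (1 - s) / (1 - w - β * s) ≤ β + 4 * w := by
    have h1 : 1 - s = (β + w) / (1 + β) := by rw [hs]; field_simp; ring
    have h2 : 1 - w - β * s = (1 - w) / (1 + β) := by rw [hs]; field_simp; ring
    rw [h1, h2, div_div_div_cancel_right₀ (by positivity), div_le_iff₀ (by linarith)]
    nlinarith [mul_le_mul_of_nonneg_right hβ1 hw0.le, mul_le_mul_of_nonneg_right hw.le hw0.le]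
  linarith

end preference

/-! ### Choice of the slack and final constants -/

theorem one_div_sqrt_le {n : ℕ} (hn : 2 ≤ n) : 1 / √(n : ℝ) ≤ 2 * (√(Real.log n) / √n) := by
  have h1 : (1 / 2 : ℝ) ≤ √(Real.log n) := by
    refine Real.le_sqrt_of_sq_le ?_
    have := Real.log_le_log (by norm_num) (by exact_mod_cast hn : (2 : ℝ) ≤ n)
    linarith [Real.log_two_gt_d9]
  rw [← mul_div_assoc]
  gcongr
  linarith

theorem prefFairness_le {n p : ℕ} {k : Fin p → ℕ} {group : Fin n → Fin 2} {β : ℝ}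
    (hp : 0 < p) (hk : ∀ ℓ, 1 ≤ k ℓ)
    (hcard : ∀ j, (groupMembers group j).card = ∑ ℓ, k ℓ) (hβ : 0 < β) (hβ1 : β ≤ 1)
    (L : Measure (Pref p)) [IsProbabilityMeasure L] (hn2 : 2 ≤ n) :
    prefFairness uniform01 L group β (stableAlg k) ≤ β + 12 * (√(Real.log n) / √n) := by
  have hK : (0 : ℝ) < (∑ ℓ, k ℓ : ℕ) := by exact_mod_cast total_capacity_pos hp hk
  have hn : (n : ℝ) = 2 * (∑ ℓ, k ℓ : ℕ) := eq_two_mul_of_card hcard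
  have hn2' : (2 : ℝ) ≤ n := by exact_mod_cast hn2
  have hlog : 0 < Real.log n := Real.log_pos (by linarith)
  set q := √(Real.log n) / √n with hq
  have hq0 : 0 < q := div_pos (Real.sqrt_pos.2 hlog) (Real.sqrt_pos.2 (by linarith))
  have hq2 : q ^ 2 = Real.log n / n := by
    rw [hq, div_pow, Real.sq_sqrt hlog.le, Real.sq_sqrt (by linarith)]
  -- Since `n = 2K`, this choice gives `K * w ^ 2 = log n`, so each exponential equals `1 / n`.
  set w := √2 * q with hw
  have hw0 : 0 < w := by positivity
  have hexp : Real.exp (-((∑ ℓ, k ℓ : ℕ) * w ^ 2)) = 1 / n := by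
    have : ((∑ ℓ, k ℓ : ℕ) : ℝ) * w ^ 2 = Real.log n := by
      rw [hw, mul_pow, Real.sq_sqrt (by norm_num), hq2, hn]
      field_simp
    rw [this, Real.exp_neg, Real.exp_log (by linarith), one_div]
  have h1 := prefFairness_le_add_exp hp hk hcard hβ hβ1 L hw0
  rw [hexp] at h1
  have h2 : 1 / (n : ℝ) ≤ 1 / √n := by
    refine one_div_le_one_div_of_le (Real.sqrt_pos.2 (by linarith)) ?_
    rw [Real.sqrt_le_left (by linarith)]
    nlinarith
  have h3 := one_div_sqrt_le hn2
  have h4 : w ≤ 2 * q := by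
    refine mul_le_mul_of_nonneg_right ?_ hq0.le
    rw [Real.sqrt_le_left (by norm_num)]; norm_num
  linarith

theorem metric_bounds {n p : ℕ} {k : Fin p → ℕ} {group : Fin n → Fin 2} {β : ℝ}
    (hp : 0 < p) (hk : ∀ ℓ, 1 ≤ k ℓ)
    (hcard : ∀ j, (groupMembers group j).card = ∑ ℓ, k ℓ) (hβ : 0 < β) (hβ1 : β ≤ 1)
    (L : Measure (Pref p)) [IsProbabilityMeasure L] :
    prefFairness uniform01 L group β (stableAlg k) ≤ β + 32 * (p * √(Real.log n) / √n) ∧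
    |reprFairness uniform01 L group β (stableAlg k) - β| ≤ 32 * (√(Real.log n) / √n) ∧
    |utilityRatio uniform01 L group β (∑ ℓ, k ℓ) (stableAlg k)
      - (2 / 3 + 4 * β / (3 * (β + 1) ^ 2))| ≤ 32 * (√(Real.log n) / √n) := by
  have hn2 : 2 ≤ n := by
    have h1 : (n : ℝ) = 2 * (∑ ℓ, k ℓ : ℕ) := eq_two_mul_of_card hcard
    have h2 : n = 2 * ∑ ℓ, k ℓ := by exact_mod_cast h1
    have := total_capacity_pos hp hk
    omega
  have h3 := one_div_sqrt_le hn2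
  have h4 : 16 / √(n : ℝ) = 16 * (1 / √n) := by ring
  have hq0 : 0 ≤ √(Real.log n) / √n := by positivity
  refine ⟨?_, ?_, ?_⟩
  · refine (prefFairness_le hp hk hcard hβ hβ1 L hn2).trans ?_
    have hp1 : (1 : ℝ) ≤ p := by exact_mod_cast hp
    rw [mul_div_assoc]
    nlinarith [mul_le_mul_of_nonneg_right hp1 hq0]
  · linarith [abs_reprFairness_sub_le hp hk hcard hβ hβ1 L]
  · linarith [abs_utilityRatio_sub_le hp hk hcard hβ hβ1 L]

end

theorem mainTheorem2 :
    ∃ C : ℝ, 0 < C ∧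
      (∀ (n p : ℕ) (_ : 0 < p) (k : Fin p → ℕ) (_ : ∀ ℓ, 1 ≤ k ℓ) (group : Fin n → Fin 2)
        (_ : ∀ j, (groupMembers group j).card = ∑ ℓ, k ℓ) (β : ℝ) (_ : 0 < β) (_ : β ≤ 1)
        (L : MeasureTheory.Measure (Pref p)) [MeasureTheory.IsProbabilityMeasure L],
          prefFairness uniform01 L group β (stableAlg k)
              ≤ β + C * (p * √(Real.log n) / √n) ∧
          |reprFairness uniform01 L group β (stableAlg k) - β|
              ≤ C * (√(Real.log n) / √n) ∧
          |utilityRatio uniform01 L group β (∑ ℓ, k ℓ) (stableAlg k)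
              - (2 / 3 + 4 * β / (3 * (β + 1) ^ 2))|
              ≤ C * (√(Real.log n) / √n)) ∧
      (∀ ε : ℝ, 0 < ε → ∃ δ : ℝ, 0 < δ ∧
        ∀ (n p : ℕ) (_ : 0 < p) (k : Fin p → ℕ) (_ : ∀ ℓ, 1 ≤ k ℓ) (group : Fin n → Fin 2)
        (_ : ∀ j, (groupMembers group j).card = ∑ ℓ, k ℓ) (β : ℝ) (_ : 0 < β) (_ : β ≤ 1)
        (L : MeasureTheory.Measure (Pref p)) [MeasureTheory.IsProbabilityMeasure L],
          β ≤ δ → √(Real.log n) / √n ≤ δ →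
          (p * √(Real.log n) / √n ≤ δ → prefFairness uniform01 L group β (stableAlg k) ≤ ε) ∧
          reprFairness uniform01 L group β (stableAlg k) ≤ ε ∧
          |utilityRatio uniform01 L group β (∑ ℓ, k ℓ) (stableAlg k) - 2 / 3| ≤ ε) := by
  -- The `34` is `32` for the error term plus `2` from `4β / (3(β + 1)²) ≤ 2β`.
  refine ⟨32, by norm_num, fun n p hp k hk group hcard β hβ hβ1 L _ =>
    metric_bounds hp hk hcard hβ hβ1 L, fun ε hε => ⟨ε / 34, by positivity, ?_⟩⟩
  intro n p hp k hk group hcard β hβ hβ1 L _ hβδ hδ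
  obtain ⟨hP, hR, hU⟩ := metric_bounds hp hk hcard hβ hβ1 L
  refine ⟨fun hpδ => by linarith, by linarith [(abs_le.1 hR).2], ?_⟩
  have h0 : 0 ≤ 4 * β / (3 * (β + 1) ^ 2) := by positivity
  have h1 : 4 * β / (3 * (β + 1) ^ 2) ≤ 2 * β := by
    rw [div_le_iff₀ (by positivity)]
    nlinarith [sq_nonneg β, mul_pos hβ hβ, mul_pos (mul_pos hβ hβ) hβ]
  rw [abs_le] at hU ⊢
  constructor <;> linarith
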